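/- Let $n\ge 1$, let $T$ take values in an arbitrary measurable space with law $P_T$, and let $P_{Z^n|T}$, $P_{Y^n|T}$ be conditional probability measures (Markov kernels) on $\mathbb R^n$ such that for every $t$, $P_{Y^n|T=t}=\mathcal N(0,I_n)$ and $P_{Z^n|T=t}\ll \mathcal N(0,I_n)$. For $R\in[0,\infty)$ let $$W_2(P_{Z^n|T},P_{Y^n|T}|P_T;R)=\inf_{P}\left\{\mathbb E_P\left[\|Z^n-Y^n\|^2\right]\right\}^{1/2},$$ where the infimum is over all joint laws $P=P_{\bar Z,\bar Y|T}\cdot P_T$ with $P_{\bar Z|T}=P_{Z^n|T}$, $P_{\bar Y|T}=P_{Y^n|T}$ and conditional mutual information $I_P(Z;Y|T)=\mathbb E_{S\sim P_T}[I(\bar Z;\bar Y|T=S)]\le R$ (in nats). Let $h(Z^n|T)=\mathbb E_{S\sim P_T}[h(Z^n|T=S)]\in[-\infty,\infty]$ be the conditional differential entropy (in nats), and let $\mathbb E[\|Z^n\|^2]\in[0,\infty]$ be computed under the law of $Z^n$ induced by $P_T$ and $P_{Z^n|T}$. Then $$W_2^2(P_{Z^n|T},P_{Y^n|T}|P_T;R)\le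 \mathbb E[\|Z^n\|^2]+n-2n\sqrt{\frac{1}{2\pi e}e^{\frac 2n h(Z^n|T)}\left(1-e^{-\frac{2R}{n}}\right)},$$ unless $\mathbb E[\|Z^n\|^2]=h(Z^n|T)=+\infty$, when the right-hand side is undefined. In particular this holds whenever $\mathbb E[\|Z^n\|^2]<\infty$. -/

import Mathlib

open MeasureTheory ProbabilityTheory
open scoped ENNReal NNReal

noncomputable section

namespace CondOT

variable {τ Ω Ω' : Type*} [MeasurableSpace τ] [MeasurableSpace Ω] [MeasurableSpace Ω']

/-- The extended-real integral `∫ f dμ = ∫ f⁺ dμ - ∫ f⁻ dμ`. It is meaningful as soon as one of the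
two parts is finite; in the indeterminate case it takes the value `⊥` (as `⊤ - ⊤ = ⊥` in
`EReal`). -/
def eintegral (μ : Measure Ω) (f : Ω → EReal) : EReal :=
  ((∫⁻ x, (f x).toENNReal ∂μ : ℝ≥0∞) : EReal) - ((∫⁻ x, (-f x).toENNReal ∂μ : ℝ≥0∞) : EReal)

/-- The differential entropy `h = -∫ f log f` (in nats) of a probability measure with density `f`
with respect to the reference measure `ν` (Lebesgue measure below). -/
def diffEntropy (ν μ : Measure Ω) : EReal :=
  eintegral ν fun x => ((Real.negMulLog (μ.rnDeriv ν x).toReal : ℝ) : EReal)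

/-- The conditional differential entropy `h(Z|T) = 𝔼_{S ∼ P_T} h(Z | T = S)`. -/
def condDiffEntropy (ν : Measure Ω) (PT : Measure τ) (PZ : Kernel τ Ω) : EReal :=
  eintegral PT fun t => diffEntropy ν (PZ t)

/-- The mutual information `I(Z;Y) = D(P_{Z,Y} ‖ P_Z ⊗ P_Y)` under the joint law `P`. -/
def mutualInfo (P : Measure (Ω × Ω')) : ℝ≥0∞ :=
  InformationTheory.klDiv P (P.fst.prod P.snd)

/-- The conditional mutual information `I(Z;Y|T) = 𝔼_{S ∼ P_T} I(Z;Y | T = S)` under the joint law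
`P_{Z,Y|T} · P_T`. -/
def condMutualInfo (PT : Measure τ) (π : Kernel τ (Ω × Ω')) : ℝ≥0∞ :=
  ∫⁻ t, mutualInfo (π t) ∂PT

/-- The conditional laws `P_{Z,Y|T}` whose marginals are `P_{Z|T}` and `P_{Y|T}`. The conditional
couplings are the joint laws `P_{Z,Y|T} · P_T`. -/
def condCouplings (PZ : Kernel τ Ω) (PY : Kernel τ Ω') : Set (Kernel τ (Ω × Ω')) :=
  {π | IsMarkovKernel π ∧ π.fst = PZ ∧ π.snd = PY}

/-- The conditional Wasserstein distance of order `p` between `P_{Z|T}` and `P_{Y|T}` given `P_T`,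
subject to the information constraint `I(Z;Y|T) ≤ R`. -/
def condInfoWasserstein [PseudoEMetricSpace Ω] (p : ℝ) (PZ PY : Kernel τ Ω) (PT : Measure τ)
    (R : ℝ≥0) : ℝ≥0∞ :=
  ⨅ π ∈ {π ∈ condCouplings PZ PY | condMutualInfo PT π ≤ (R : ℝ≥0∞)},
    (∫⁻ x, edist x.2.1 x.2.2 ^ p ∂(PT ⊗ₘ π)) ^ (1 / p)

/-- The second moment `𝔼 ‖Z‖²`, where `Z` has the law `∫ P_{Z|T=t} dP_T(t)`. -/
def secondMoment [ENorm Ω] (PT : Measure τ) (PZ : Kernel τ Ω) : ℝ≥0∞ :=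
  ∫⁻ z, ‖z‖ₑ ^ 2 ∂(PT.bind PZ)

/-- The conditional entropy power `(1 / (2πe)) e^{(2/n) h(Z|T)}` of an `n`-dimensional random
vector. -/
def condEntropyPower (n : ℕ) (PT : Measure τ) (PZ : Kernel τ (EuclideanSpace ℝ (Fin n))) : ℝ≥0∞ :=
  ENNReal.ofReal (1 / (2 * Real.pi * Real.exp 1)) *
    EReal.exp (((2 / n : ℝ) : EReal) * condDiffEntropy volume PT PZ)

end CondOT

end

/-!
Fix a value `t` of the condition and let `Z` have the law `P_{Z|T=t}`, with density `f`. The proof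
couples `Z` with a standard Gaussian vector `G(Z)`, a deterministic function of `Z`, for which
`𝔼⟪Z, G(Z)⟫ ≥ n exp((h(Z) - h(γ)) / n)`, where `γ` is the standard Gaussian law, and then puts
`Y = ρ G(Z) + σ W` with `W` an independent standard Gaussian vector, `σ² = exp(-2R/n)` and
`ρ² + σ² = 1`. Then `Y` is standard Gaussian, `𝔼‖Z - Y‖² = 𝔼‖Z‖² + n - 2ρ 𝔼⟪Z, G(Z)⟫`, and the joint
law of `(Z, Y)` has the Mehler kernel at `(G(Z), Y)` as density with respect to the product of its
marginals, so that the mutual information is exactly `-(n/2) log σ² = R` (`mutualInfo_map_noisy`).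

On the line `G = Φ⁻¹ ∘ F` is the monotone rearrangement (`toGaussian`). No differentiability is
used: writing `Z` as a layer-cake integral and using `∫_a^∞ y dγ = φ(a)` for the Gaussian density
`φ`, one finds `𝔼[Z G(Z)] = ∫ φ(G(x)) dx ≥ 𝔼[φ(G(Z)) / f(Z)]`
(`lintegral_gaussianPDFReal_div_le`). The inequality between `𝔼[Z G(Z)]` and the entropy follows
from `log (φ(G) / f) ≤ l φ(G) / f - 1 - log l`, for every slope `l > 0`. In this affine form the
bound adds up over coordinates and averages over conditions. Hence it passes to the Knothe map on
`ℝⁿ`, which rearranges each coordinate conditionally on the previous ones, by induction on `n`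
(`exists_isGaussianTransport`, where the maps also depend measurably on `t`); it can be integrated
over `t`; and only at the end is it optimized over `l` (`entropyPower_le_sq`), which replaces all
uses of Jensen's inequality and of the chain rule for entropies.

The work is done on `Fin n → ℝ` and transferred to `EuclideanSpace ℝ (Fin n)` at the end. If the
second moment is infinite the right-hand side is `⊤` and there is nothing to prove.
-/

namespace CondOT

open Set Filter Topology

/-! ### Monotone rearrangement to the Gaussian law on the line -/

section Cdf

variable (μ : Measure ℝ) [IsProbabilityMeasure μ] [NullSingletonClass μ]

lemma continuous_cdf : Continuous (cdf μ) := by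
  rw [continuous_iff_continuousAt]
  intro x
  rw [(monotone_cdf μ).continuousAt_iff_leftLim_eq_rightLim, StieltjesFunction.rightLim_eq]
  have h := (cdf μ).measure_singleton x
  rw [measure_cdf, measure_singleton] at h
  have h1 := ENNReal.ofReal_eq_zero.1 h.symm
  exact le_antisymm ((monotone_cdf μ).leftLim_le le_rfl) (by linarith)

lemma exists_cdf_eq {u : ℝ} (hu : u ∈ Ioo (0 : ℝ) 1) : ∃ x, cdf μ x = u := by
  obtain ⟨a, ha⟩ := ((tendsto_cdf_atBot μ).eventually_lt_const hu.1).exists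
  obtain ⟨b, hb⟩ := ((tendsto_cdf_atTop μ).eventually_const_lt hu.2).exists
  exact mem_range_of_exists_le_of_exists_ge (continuous_cdf μ) ⟨a, ha.le⟩ ⟨b, hb.le⟩

/-- The probability integral transform: the distribution function of an atomless law, evaluated
at a point drawn from that law, is uniformly distributed. -/
lemma measure_cdf_le {u : ℝ} (hu : u ∈ Ioo (0 : ℝ) 1) :
    μ {x | cdf μ x ≤ u} = ENNReal.ofReal u := by
  obtain ⟨x₀, hx₀⟩ := exists_cdf_eq μ hu
  obtain ⟨b, hb⟩ := ((tendsto_cdf_atTop μ).eventually_const_lt hu.2).exists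
  set S := {x | cdf μ x ≤ u}
  have hbdd : BddAbove S := ⟨b, fun x hx => by
    by_contra! h
    exact absurd (monotone_cdf μ h.le) (not_le.2 (lt_of_le_of_lt hx hb))⟩
  have hcl : IsClosed S := isClosed_le (continuous_cdf μ) continuous_const
  have hmem : sSup S ∈ S := hcl.csSup_mem ⟨x₀, hx₀.le⟩ hbdd
  have hS : S = Iic (sSup S) := by
    ext x
    exact ⟨fun hx => le_csSup hbdd hx, fun hx => (monotone_cdf μ hx).trans hmem⟩
  rw [hS, ← ofReal_cdf]
  congr 1
  exact le_antisymm hmem (hx₀ ▸ monotone_cdf μ (le_csSup hbdd hx₀.le))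

lemma ae_cdf_mem_Ioo : ∀ᵐ x ∂μ, cdf μ x ∈ Ioo (0 : ℝ) 1 := by
  have h0 : ∀ᵐ x ∂μ, 0 < cdf μ x := by
    simp only [ae_iff, not_lt]
    refine le_antisymm (ENNReal.le_of_forall_pos_le_add fun ε hε _ => ?_) zero_le
    have hm : min (ε : ℝ) (1 / 2) ∈ Ioo (0 : ℝ) 1 :=
      ⟨lt_min hε (by norm_num), (min_le_right _ _).trans_lt (by norm_num)⟩
    calc μ {x | cdf μ x ≤ 0} ≤ μ {x | cdf μ x ≤ min (ε : ℝ) (1 / 2)} :=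
          measure_mono fun x (hx : cdf μ x ≤ 0) => hx.trans hm.1.le
      _ = ENNReal.ofReal (min (ε : ℝ) (1 / 2)) := measure_cdf_le μ hm
      _ ≤ ENNReal.ofReal ε := ENNReal.ofReal_le_ofReal (min_le_left _ _)
      _ = 0 + ε := by simp
  have h1 : ∀ᵐ x ∂μ, cdf μ x < 1 := by
    have : μ {x | cdf μ x < 1} = 1 := by
      refine le_antisymm prob_le_one (le_of_forall_lt fun c hc => ?_)
      obtain ⟨d, hcd, hd⟩ := exists_between hc
      have hdt : d ≠ ∞ := (hd.trans ENNReal.one_lt_top).ne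
      have hm : d.toReal ∈ Ioo (0 : ℝ) 1 :=
        ⟨ENNReal.toReal_pos (pos_of_gt hcd).ne' hdt,
          by simpa using (ENNReal.toReal_lt_toReal hdt ENNReal.one_ne_top).2 hd⟩
      refine hcd.trans_le ?_
      calc d = μ {x | cdf μ x ≤ d.toReal} := by rw [measure_cdf_le μ hm, ENNReal.ofReal_toReal hdt]
        _ ≤ _ := measure_mono fun x (hx : cdf μ x ≤ d.toReal) => hx.trans_lt hm.2
    rw [← prob_compl_eq_zero_iff (measurableSet_lt (monotone_cdf μ).measurable measurable_const)]
      at this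
    exact this
  filter_upwards [h0, h1] with x h h' using ⟨h, h'⟩

end Cdf

section Probit

instance : NullSingletonClass (gaussianReal 0 1) := nullSingletonClass_gaussianReal one_ne_zero

lemma strictMono_cdf_gaussianReal : StrictMono (cdf (gaussianReal 0 1)) := by
  intro a b hab
  rw [← sub_pos]
  have h := (cdf (gaussianReal 0 1)).measure_Ioc a b
  rw [measure_cdf] at h
  have h0 : gaussianReal 0 1 (Ioc a b) ≠ 0 := fun h0 => by
    have := gaussianReal_absolutelyContinuous' 0 one_ne_zero h0
    simp at this
    linarith
  rw [h] at h0
  simpa using h0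

lemma measurableEmbedding_cdf_gaussianReal : MeasurableEmbedding (cdf (gaussianReal 0 1)) :=
  (continuous_cdf _).measurableEmbedding strictMono_cdf_gaussianReal.injective

/-- The quantile function of the standard Gaussian law (with an arbitrary value outside
`(0, 1)`). -/
noncomputable def probit : ℝ → ℝ := measurableEmbedding_cdf_gaussianReal.invFun

lemma cdf_probit {u : ℝ} (hu : u ∈ Ioo (0 : ℝ) 1) : cdf (gaussianReal 0 1) (probit u) = u := by
  obtain ⟨x, rfl⟩ := exists_cdf_eq (gaussianReal 0 1) hu
  rw [probit, measurableEmbedding_cdf_gaussianReal.leftInverse_invFun]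

lemma measurable_probit : Measurable probit :=
  measurableEmbedding_cdf_gaussianReal.measurable_invFun

lemma cdf_gaussianReal_mem_Ioo (y : ℝ) : cdf (gaussianReal 0 1) y ∈ Ioo (0 : ℝ) 1 :=
  ⟨(cdf_nonneg _ (y - 1)).trans_lt (strictMono_cdf_gaussianReal (by linarith)),
    (strictMono_cdf_gaussianReal (by linarith)).trans_le (cdf_le_one _ (y + 1))⟩

lemma setIntegral_Ioi_gaussianReal (a : ℝ) :
    ∫ y in Ioi a, y ∂gaussianReal 0 1 = gaussianPDFReal 0 1 a := by
  have hd : ∀ x, HasDerivAt (fun y => -gaussianPDFReal 0 1 y) (gaussianPDFReal 0 1 x * x) x := by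
    intro x
    have h1 : HasDerivAt (fun y : ℝ => -(y - 0) ^ 2 / (2 * ((1 : ℝ≥0) : ℝ))) (-x) x := by
      have := ((hasDerivAt_id x).sub_const 0).pow 2 |>.neg.div_const (2 * ((1 : ℝ≥0) : ℝ))
      refine this.congr_deriv ?_
      simp; ring
    have h2 := (h1.exp.const_mul (√(2 * Real.pi * ((1 : ℝ≥0) : ℝ)))⁻¹).neg
    refine h2.congr_deriv ?_
    rw [gaussianPDFReal]; ring
  have hint : Integrable (fun y => gaussianPDFReal 0 1 y * y) := by
    have h : Integrable (fun y : ℝ => y) (gaussianReal 0 1) := IsGaussian.integrable_id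
    rw [gaussianReal_of_var_ne_zero 0 one_ne_zero,
      integrable_withDensity_iff_integrable_smul' (measurable_gaussianPDF 0 1)
        (ae_of_all _ fun _ => gaussianPDF_lt_top)] at h
    simpa using h
  have hlim : Tendsto (fun y => -gaussianPDFReal 0 1 y) atTop (𝓝 0) := by
    have : Tendsto (fun y : ℝ => Real.exp (-(y - 0) ^ 2 / (2 * ((1 : ℝ≥0) : ℝ)))) atTop (𝓝 0) := by
      refine Real.tendsto_exp_atBot.comp ?_
      have : Tendsto (fun y : ℝ => y ^ 2 / 2) atTop atTop :=
        (tendsto_pow_atTop two_ne_zero).atTop_div_const (by norm_num)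
      refine (tendsto_neg_atTop_atBot.comp this).congr fun y => ?_
      simp; ring
    simpa [gaussianPDFReal] using (this.const_mul (√(2 * Real.pi * ((1 : ℝ≥0) : ℝ)))⁻¹).neg
  have h := integral_Ioi_of_hasDerivAt_of_tendsto' (a := a) (fun x _ => hd x) hint.integrableOn hlim
  rw [gaussianReal_of_var_ne_zero 0 one_ne_zero,
    setIntegral_withDensity_eq_setIntegral_toReal_smul (measurable_gaussianPDF 0 1)
      (ae_of_all _ fun _ => gaussianPDF_lt_top) _ measurableSet_Ioi]
  simpa using h

end Probit

section Rearrangement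

variable (μ : Measure ℝ)

/-- The nondecreasing map `Φ⁻¹ ∘ F` carrying an atomless law with distribution function `F` to the
standard Gaussian law. -/
noncomputable def toGaussian (x : ℝ) : ℝ := probit (cdf μ x)

lemma measurable_toGaussian : Measurable (toGaussian μ) :=
  measurable_probit.comp (monotone_cdf μ).measurable

variable [IsProbabilityMeasure μ] [NullSingletonClass μ]

lemma map_toGaussian : μ.map (toGaussian μ) = gaussianReal 0 1 := by
  have := Measure.isProbabilityMeasure_map (μ := μ) (measurable_toGaussian μ).aemeasurable
  apply Measure.eq_of_cdf
  ext y
  have hm := cdf_gaussianReal_mem_Ioo y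
  have : μ.map (toGaussian μ) (Iic y) = ENNReal.ofReal (cdf (gaussianReal 0 1) y) := by
    rw [Measure.map_apply (measurable_toGaussian μ) measurableSet_Iic, ← measure_cdf_le μ hm]
    apply measure_congr
    filter_upwards [ae_cdf_mem_Ioo μ] with x hx
    apply propext
    change toGaussian μ x ≤ y ↔ cdf μ x ≤ cdf (gaussianReal 0 1) y
    rw [← strictMono_cdf_gaussianReal.le_iff_le, toGaussian, cdf_probit hx]
  rw [cdf_eq_real, Measure.real, this, ENNReal.toReal_ofReal hm.1.le]

lemma integrable_toGaussian_sq : Integrable (fun x => toGaussian μ x ^ 2) μ := by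
  have h : Integrable (fun y : ℝ => y ^ 2) (μ.map (toGaussian μ)) := by
    rw [map_toGaussian]
    exact (memLp_id_gaussianReal 2).integrable_sq
  exact h.comp_measurable (measurable_toGaussian μ)

lemma integrable_toGaussian : Integrable (toGaussian μ) μ := by
  have h : Integrable (fun y : ℝ => y) (μ.map (toGaussian μ)) := by
    rw [map_toGaussian]
    exact IsGaussian.integrable_id
  exact h.comp_measurable (measurable_toGaussian μ)

lemma integral_toGaussian : ∫ x, toGaussian μ x ∂μ = 0 := by
  have := integral_map (μ := μ) (measurable_toGaussian μ).aemeasurable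
    (f := fun y : ℝ => y) (by fun_prop)
  rw [← this, map_toGaussian, integral_id_gaussianReal]

/-- The part of the Gaussian mean above the level `toGaussian μ x` is the Gaussian density at that
level. -/
lemma setIntegral_Ioi_toGaussian {x : ℝ} (hx : cdf μ x ∈ Ioo (0 : ℝ) 1) :
    ∫ z in Ioi x, toGaussian μ z ∂μ = gaussianPDFReal 0 1 (toGaussian μ x) := by
  have hG := measurable_toGaussian μ
  have hsub : {z | cdf μ x < cdf μ z} ⊆ Ioi x := fun z hz => by
    by_contra h
    exact absurd (monotone_cdf μ (not_lt.1 h)) (not_le.2 hz)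
  have hcompl : {z | cdf μ x < cdf μ z} = {z | cdf μ z ≤ cdf μ x}ᶜ := by ext z; simp
  have hms : MeasurableSet {z | cdf μ z ≤ cdf μ x} :=
    measurableSet_le (monotone_cdf μ).measurable measurable_const
  have hae : {z | cdf μ x < cdf μ z} =ᵐ[μ] Ioi x := by
    refine ae_eq_of_subset_of_measure_ge hsub ?_ (by rw [hcompl]; exact hms.compl.nullMeasurableSet)
      (measure_ne_top _ _)
    rw [hcompl, ← compl_Iic, prob_compl_eq_one_sub measurableSet_Iic, prob_compl_eq_one_sub hms,
      measure_cdf_le μ hx, ofReal_cdf]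
  have hae' : toGaussian μ ⁻¹' Ioi (toGaussian μ x) =ᵐ[μ] Ioi x := by
    refine EventuallyEq.trans ?_ hae
    filter_upwards [ae_cdf_mem_Ioo μ] with z hz
    apply propext
    change toGaussian μ x < toGaussian μ z ↔ cdf μ x < cdf μ z
    rw [← strictMono_cdf_gaussianReal.lt_iff_lt, toGaussian, toGaussian, cdf_probit hz,
      cdf_probit hx]
  rw [← setIntegral_congr_set hae', ← setIntegral_Ioi_gaussianReal, ← map_toGaussian μ,
    setIntegral_map measurableSet_Ioi (by fun_prop) hG.aemeasurable]

lemma setIntegral_Ioi_toGaussian_eq_zero {x : ℝ} (hx : cdf μ x ∉ Ioo (0 : ℝ) 1) :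
    ∫ z in Ioi x, toGaussian μ z ∂μ = 0 := by
  by_cases h0 : cdf μ x = 0
  · have h : μ (Iic x) = 0 := by rw [← ofReal_cdf, h0]; simp
    have : Ioi x =ᵐ[μ] univ := by
      rw [← compl_Iic]
      exact eventuallyEq_univ.2 (compl_mem_ae_iff.2 h)
    rw [setIntegral_congr_set this, setIntegral_univ, integral_toGaussian]
  · have h1 : cdf μ x = 1 := by
      by_contra h1
      exact hx ⟨lt_of_le_of_ne (cdf_nonneg μ x) (Ne.symm h0), lt_of_le_of_ne (cdf_le_one μ x) h1⟩
    have h : μ (Ioi x) = 0 := by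
      rw [← compl_Iic, prob_compl_eq_zero_iff measurableSet_Iic, ← ofReal_cdf, h1]; simp
    exact setIntegral_measure_zero _ h

lemma setIntegral_Ioi_toGaussian_nonneg (x : ℝ) : 0 ≤ ∫ z in Ioi x, toGaussian μ z ∂μ := by
  by_cases hx : cdf μ x ∈ Ioo (0 : ℝ) 1
  · rw [setIntegral_Ioi_toGaussian μ hx]; exact gaussianPDFReal_nonneg _ _ _
  · rw [setIntegral_Ioi_toGaussian_eq_zero μ hx]

/-- The layer-cake kernel `1_{0 ≤ x < z} - 1_{z ≤ x < 0}`, whose integral over `x` is `z`. -/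
noncomputable def layer (x z : ℝ) : ℝ :=
  (Ico 0 z).indicator 1 x - (Ico z 0).indicator 1 x

lemma layer_eq (x z : ℝ) : layer x z = (Ioi x).indicator 1 z - (Iio 0).indicator 1 x := by
  simp only [layer, indicator_apply, mem_Ico, mem_Ioi, mem_Iio, Pi.one_apply]
  split_ifs <;> first | (norm_num; done) | (exfalso; grind)

lemma measurable_layer : Measurable (Function.uncurry layer) := by
  have h : Function.uncurry layer = fun p : ℝ × ℝ =>
      {q : ℝ × ℝ | q.1 < q.2}.indicator 1 p - (Iio (0 : ℝ)).indicator 1 p.1 := by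
    ext ⟨x, z⟩
    simp [Function.uncurry, layer_eq, indicator_apply]
  rw [h]
  exact (measurable_one.indicator (measurableSet_lt measurable_fst measurable_snd)).sub
    ((measurable_one.indicator measurableSet_Iio).comp measurable_fst)

lemma integrable_indicator_Ico (a b : ℝ) : Integrable ((Ico a b).indicator (1 : ℝ → ℝ)) :=
  (integrable_indicator_iff measurableSet_Ico).2 (integrableOn_const (by simp))

lemma integrable_layer (z : ℝ) : Integrable fun x => layer x z :=
  (integrable_indicator_Ico 0 z).sub (integrable_indicator_Ico z 0)

lemma integral_layer (z : ℝ) : ∫ x, layer x z = z := by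
  simp only [layer]
  rw [integral_sub (integrable_indicator_Ico 0 z) (integrable_indicator_Ico z 0),
    integral_indicator_one measurableSet_Ico, integral_indicator_one measurableSet_Ico]
  simp only [Measure.real, Real.volume_Ico]
  rcases le_total 0 z with h | h
  · rw [ENNReal.ofReal_of_nonpos (by linarith : 0 - z ≤ 0), ENNReal.toReal_ofReal (by linarith)]
    simp
  · rw [ENNReal.ofReal_of_nonpos (by linarith : z - 0 ≤ 0), ENNReal.toReal_ofReal (by linarith)]
    simp

lemma integral_abs_layer (z : ℝ) : ∫ x, |layer x z| = |z| := by
  have : ∀ x, |layer x z| = (if 0 ≤ z then 1 else -1) * layer x z := by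
    intro x
    simp only [layer, indicator_apply, mem_Ico, Pi.one_apply]
    split_ifs <;> first | (norm_num; done) | (exfalso; grind)
  simp only [this]
  rw [integral_const_mul, integral_layer]
  split_ifs with h
  · rw [one_mul, abs_of_nonneg h]
  · rw [abs_of_neg (not_le.1 h)]; ring

variable {μ}

lemma integrable_layer_mul_toGaussian (h2 : Integrable (fun z : ℝ => z ^ 2) μ) :
    Integrable (fun p : ℝ × ℝ => layer p.1 p.2 * toGaussian μ p.2) (volume.prod μ) := by
  have hm : Measurable fun p : ℝ × ℝ => layer p.1 p.2 * toGaussian μ p.2 :=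
    measurable_layer.mul ((measurable_toGaussian μ).comp measurable_snd)
  rw [integrable_prod_iff' hm.aestronglyMeasurable]
  refine ⟨ae_of_all _ fun z => (integrable_layer z).mul_const (toGaussian μ z), ?_⟩
  simp only [Real.norm_eq_abs, abs_mul, integral_mul_const, integral_abs_layer]
  have ha : MemLp (fun z : ℝ => |z|) 2 μ :=
    ((memLp_two_iff_integrable_sq measurable_id.aestronglyMeasurable).2 h2).abs
  have hb : MemLp (fun z : ℝ => |toGaussian μ z|) 2 μ :=
    ((memLp_two_iff_integrable_sq (measurable_toGaussian μ).aestronglyMeasurable).2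
      (integrable_toGaussian_sq μ)).abs
  exact ha.integrable_mul hb

lemma integral_layer_mul_toGaussian (x : ℝ) :
    ∫ z, layer x z * toGaussian μ z ∂μ = ∫ z in Ioi x, toGaussian μ z ∂μ := by
  have h1 : Integrable ((Ioi x).indicator (toGaussian μ)) μ :=
    (integrable_toGaussian μ).indicator measurableSet_Ioi
  have h2 : Integrable (fun z => (Iio (0 : ℝ)).indicator 1 x * toGaussian μ z) μ :=
    (integrable_toGaussian μ).const_mul _
  have : ∀ z, layer x z * toGaussian μ z =
      (Ioi x).indicator (toGaussian μ) z - (Iio (0 : ℝ)).indicator 1 x * toGaussian μ z := by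
    intro z
    rw [layer_eq, sub_mul]
    congr 1
    simp [indicator_apply]
  simp only [this]
  rw [integral_sub h1 h2, integral_indicator measurableSet_Ioi, integral_const_mul,
    integral_toGaussian]
  simp

/-- An integration by parts: `𝔼[Z Φ⁻¹(F(Z))]` is the integral of the partial means. -/
lemma integral_mul_toGaussian (h2 : Integrable (fun z : ℝ => z ^ 2) μ) :
    Integrable (fun x => ∫ z in Ioi x, toGaussian μ z ∂μ) ∧
      ∫ z, z * toGaussian μ z ∂μ = ∫ x, ∫ z in Ioi x, toGaussian μ z ∂μ := by
  have h := integrable_layer_mul_toGaussian h2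
  have hl := h.integral_prod_left
  simp only [integral_layer_mul_toGaussian] at hl
  refine ⟨hl, ?_⟩
  have hs := integral_integral_swap (f := fun x z => layer x z * toGaussian μ z) h
  simp only [integral_layer_mul_toGaussian, integral_mul_const, integral_layer] at hs
  exact hs.symm

end Rearrangement

section Density

/-- For a law on the line with density `f`, the derivative of the inverse of `toGaussian` at
`toGaussian x`, namely `φ(toGaussian x) / f x` with `φ` the Gaussian density, has mean at most
`𝔼[Z Φ⁻¹(F(Z))]`. -/
lemma lintegral_gaussianPDFReal_div_le {f : ℝ → ℝ≥0∞} (hf : Measurable f)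
    [IsProbabilityMeasure (volume.withDensity f)]
    (h2 : Integrable (fun z : ℝ => z ^ 2) (volume.withDensity f)) :
    0 ≤ ∫ z, z * toGaussian (volume.withDensity f) z ∂volume.withDensity f ∧
    ∫⁻ x, ENNReal.ofReal (gaussianPDFReal 0 1 (toGaussian (volume.withDensity f) x) / (f x).toReal)
        ∂volume.withDensity f ≤
      ENNReal.ofReal (∫ z, z * toGaussian (volume.withDensity f) z ∂volume.withDensity f) := by
  set μ := volume.withDensity f with hμ
  obtain ⟨hi, he⟩ := integral_mul_toGaussian h2
  rw [he]
  have hnn := setIntegral_Ioi_toGaussian_nonneg μ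
  refine ⟨integral_nonneg hnn, ?_⟩
  rw [ofReal_integral_eq_lintegral_ofReal hi (ae_of_all _ hnn)]
  set g : ℝ → ℝ≥0∞ := fun x =>
    ENNReal.ofReal (gaussianPDFReal 0 1 (toGaussian μ x) / (f x).toReal) with hg
  have hgm : Measurable g := ENNReal.measurable_ofReal.comp
    (((measurable_gaussianPDFReal 0 1).comp (measurable_toGaussian μ)).div hf.ennreal_toReal)
  have hsm : MeasurableSet {x | cdf μ x ∈ Ioo (0 : ℝ) 1} :=
    (monotone_cdf μ).measurable measurableSet_Ioo
  have h1 : ∫⁻ x, g x ∂μ = ∫⁻ x, {x | cdf μ x ∈ Ioo (0 : ℝ) 1}.indicator g x ∂μ := by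
    apply lintegral_congr_ae
    filter_upwards [ae_cdf_mem_Ioo μ] with x hx
    exact (indicator_of_mem (s := {x | cdf μ x ∈ Ioo (0 : ℝ) 1}) hx g).symm
  rw [h1, hμ, lintegral_withDensity_eq_lintegral_mul _ hf (hgm.indicator hsm)]
  refine lintegral_mono fun x => ?_
  rw [Pi.mul_apply]
  by_cases hx : cdf μ x ∈ Ioo (0 : ℝ) 1
  · rw [setIntegral_Ioi_toGaussian μ hx,
      indicator_of_mem (s := {x | cdf μ x ∈ Ioo (0 : ℝ) 1}) hx g, hg]
    rcases eq_or_ne (f x) 0 with h0 | h0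
    · simp [h0]
    rcases eq_or_ne (f x) ∞ with ht | ht
    · simp [ht]
    have hp : 0 < (f x).toReal := ENNReal.toReal_pos h0 ht
    beta_reduce
    nth_rewrite 1 [← ENNReal.ofReal_toReal ht]
    rw [← ENNReal.ofReal_mul hp.le, mul_div_cancel₀ _ hp.ne']
  · rw [indicator_of_notMem (s := {x | cdf μ x ∈ Ioo (0 : ℝ) 1}) hx]
    simp

/-- The tangent-line bound for the logarithm, in the form in which it is integrated later: the
free slope `l` replaces an application of Jensen's inequality. -/
lemma log_sub_log_le {a b l : ℝ} (ha : 0 < a) (hb : 0 < b) (hl : 0 < l) :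
    Real.log a - Real.log b ≤ l * (a / b) - (1 + Real.log l) := by
  have h := Real.log_le_sub_one_of_pos (mul_pos hl (div_pos ha hb))
  rw [Real.log_mul hl.ne' (div_pos ha hb).ne', Real.log_div ha.ne' hb.ne'] at h
  linarith

end Density

/-! ### The Knothe rearrangement -/

section Prelim

/-- A product of measures with densities has the product of the densities as its density. -/
lemma pi_withDensity {ι : Type*} [Fintype ι] {α : ι → Type*} [∀ i, MeasurableSpace (α i)]
    (μ : ∀ i, Measure (α i)) [∀ i, SigmaFinite (μ i)] (f : ∀ i, α i → ℝ≥0∞)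
    (hf : ∀ i, Measurable (f i)) [∀ i, IsFiniteMeasure ((μ i).withDensity (f i))] :
    Measure.pi (fun i => (μ i).withDensity (f i)) =
      (Measure.pi μ).withDensity fun x => ∏ i, f i (x i) := by
  have hfin : ∀ i, ∫⁻ x, f i x ∂μ i ≠ ∞ := fun i => by
    have := measure_ne_top ((μ i).withDensity (f i)) univ
    rwa [withDensity_apply _ MeasurableSet.univ, setLIntegral_univ] at this
  have hlt : ∀ i, ∀ᵐ x ∂μ i, f i x < ∞ := fun i => ae_lt_top (hf i) (hfin i)
  have hint : ∀ i, Integrable (fun x => (f i x).toReal) (μ i) := fun i =>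
    integrable_toReal_of_lintegral_ne_top (hf i).aemeasurable (hfin i)
  refine Measure.pi_eq fun s hs => ?_
  have hpre : ∀ i, ∀ᵐ x ∂Measure.pi μ, f i (x i) < ∞ := fun i =>
    (Measure.quasiMeasurePreserving_eval μ i).ae (hlt i)
  have hg : ∀ i, Integrable ((s i).indicator fun x => (f i x).toReal) (μ i) := fun i =>
    (hint i).indicator (hs i)
  have hgn : ∀ i x, 0 ≤ (s i).indicator (fun x => (f i x).toReal) x := fun i x =>
    indicator_nonneg (fun _ _ => ENNReal.toReal_nonneg) _
  have hms : MeasurableSet (univ.pi s) := MeasurableSet.univ_pi hs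
  have hfac : ∀ i, (μ i).withDensity (f i) (s i) =
      ENNReal.ofReal (∫ x, (s i).indicator (fun x => (f i x).toReal) x ∂μ i) := fun i => by
    rw [ofReal_integral_eq_lintegral_ofReal (hg i) (ae_of_all _ (hgn i)), withDensity_apply _ (hs i),
      ← lintegral_indicator (hs i)]
    refine lintegral_congr_ae ?_
    filter_upwards [hlt i] with x hx
    by_cases h : x ∈ s i <;> simp [h, ENNReal.ofReal_toReal hx.ne]
  simp only [hfac]
  rw [← ENNReal.ofReal_prod_of_nonneg (fun i _ => integral_nonneg (hgn i)),
    ← integral_fintype_prod_eq_prod (E := α) (μ := μ) (𝕜 := ℝ)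
      (fun i => (s i).indicator fun x => (f i x).toReal),
    ofReal_integral_eq_lintegral_ofReal (Integrable.fintype_prod_dep hg)
      (ae_of_all _ fun x => Finset.prod_nonneg fun i _ => hgn i (x i)),
    withDensity_apply _ hms, ← lintegral_indicator hms]
  refine lintegral_congr_ae ?_
  filter_upwards [ae_all_iff.2 hpre] with x hx
  rw [ENNReal.ofReal_prod_of_nonneg fun i _ => hgn i (x i)]
  by_cases h : x ∈ univ.pi s
  · rw [indicator_of_mem h]
    refine Finset.prod_congr rfl fun i _ => ?_
    rw [indicator_of_mem (h i (mem_univ i)), ENNReal.ofReal_toReal (hx i).ne]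
  · rw [indicator_of_notMem h]
    obtain ⟨i, hi⟩ : ∃ i, x i ∉ s i := by simpa [Set.mem_pi] using h
    exact (Finset.prod_eq_zero (Finset.mem_univ i) (by simp [hi])).symm

lemma isProbabilityMeasure_withDensity_iff {α : Type*} [MeasurableSpace α] {ν : Measure α}
    {f : α → ℝ≥0∞} : IsProbabilityMeasure (ν.withDensity f) ↔ ∫⁻ x, f x ∂ν = 1 := by
  rw [isProbabilityMeasure_iff, withDensity_apply _ MeasurableSet.univ, setLIntegral_univ]

lemma ae_withDensity_toReal_pos {α : Type*} [MeasurableSpace α] {ν : Measure α}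
    {f : α → ℝ≥0∞} (hf : Measurable f) (h : ∫⁻ x, f x ∂ν ≠ ∞) :
    ∀ᵐ x ∂ν.withDensity f, 0 < (f x).toReal := by
  rw [ae_withDensity_iff hf]
  filter_upwards [ae_lt_top hf h] with x hx h0 using ENNReal.toReal_pos h0 hx.ne

/-- The standard Gaussian law on `Fin n → ℝ`. -/
noncomputable abbrev piGaussian (n : ℕ) : Measure (Fin n → ℝ) :=
  Measure.pi fun _ => gaussianReal 0 1

lemma piGaussian_eq_withDensity (n : ℕ) :
    piGaussian n = volume.withDensity fun x => ∏ i, gaussianPDF 0 1 (x i) := by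
  have : IsProbabilityMeasure ((volume : Measure ℝ).withDensity (gaussianPDF 0 1)) := by
    rw [← gaussianReal_of_var_ne_zero 0 one_ne_zero]; infer_instance
  simp only [piGaussian, gaussianReal_of_var_ne_zero 0 one_ne_zero]
  exact pi_withDensity _ _ fun _ => measurable_gaussianPDF 0 1

lemma measurable_prod_gaussianPDF (n : ℕ) :
    Measurable fun x : Fin n → ℝ => ∏ i, gaussianPDF 0 1 (x i) :=
  Finset.measurable_prod _ fun i _ => (measurable_gaussianPDF 0 1).comp (measurable_pi_apply i)

lemma lintegral_prod_gaussianPDF (n : ℕ) :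
    ∫⁻ x : Fin n → ℝ, ∏ i, gaussianPDF 0 1 (x i) = 1 := by
  rw [← isProbabilityMeasure_withDensity_iff, ← piGaussian_eq_withDensity]
  infer_instance

lemma measurable_cdf_withDensity {τ : Type*} [MeasurableSpace τ] {f : τ → ℝ → ℝ≥0∞}
    (hf : Measurable (Function.uncurry f))
    (h1 : ∀ t, IsProbabilityMeasure (volume.withDensity (f t))) :
    Measurable fun p : τ × ℝ => cdf (volume.withDensity (f p.1)) p.2 := by
  have : (fun p : τ × ℝ => cdf (volume.withDensity (f p.1)) p.2) = fun p : τ × ℝ =>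
      (∫⁻ y, {q : (τ × ℝ) × ℝ | q.2 ≤ q.1.2}.indicator (fun q => f q.1.1 q.2) (p, y)).toReal := by
    ext p
    have := h1 p.1
    rw [cdf_eq_real, Measure.real, withDensity_apply _ measurableSet_Iic,
      ← lintegral_indicator measurableSet_Iic]
    rfl
  rw [this]
  refine Measurable.ennreal_toReal (Measurable.lintegral_prod_right' ?_)
  refine Measurable.indicator ?_ (measurableSet_le measurable_snd measurable_fst.snd)
  exact hf.comp (measurable_fst.fst.prodMk measurable_snd)

end Prelim

section Knothe

variable {n : ℕ}

/-- `G` carries the law with density `f` on `Fin n → ℝ` to the standard Gaussian law, and `r`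
(for the triangular maps constructed below: the divergence of the inverse of `G`, evaluated at the
image point) witnesses the transport inequality: it bounds the logarithm of the ratio of the
two densities, up to the choice of a slope `l`, and its mean is at most `𝔼⟪Z, G Z⟫`. -/
structure IsGaussianTransport (f : (Fin n → ℝ) → ℝ≥0∞) (G : (Fin n → ℝ) → Fin n → ℝ)
    (r : (Fin n → ℝ) → ℝ) : Prop where
  measurable_map : Measurable G
  measurable_rate : Measurable r
  nonneg : ∀ z, 0 ≤ r z
  map_eq : (volume.withDensity f).map G = piGaussian n
  log_le : ∀ l : ℝ, 0 < l → ∀ᵐ z ∂volume.withDensity f,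
    ∑ i, Real.log (gaussianPDFReal 0 1 (G z i)) - Real.log (f z).toReal ≤
      l * r z - n * (1 + Real.log l)
  moment : (∀ i, Integrable (fun z : Fin n → ℝ => z i ^ 2) (volume.withDensity f)) →
    0 ≤ ∫ z, ∑ i, z i * G z i ∂volume.withDensity f ∧
    ∫⁻ z, ENNReal.ofReal (r z) ∂volume.withDensity f ≤
      ENNReal.ofReal (∫ z, ∑ i, z i * G z i ∂volume.withDensity f)

lemma integrable_eval_sq_of_map_eq {α : Type*} [MeasurableSpace α] {κ : Measure α}
    {G : α → Fin n → ℝ} (hG : Measurable G) (h : κ.map G = piGaussian n) (i : Fin n) :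
    Integrable (fun z => G z i ^ 2) κ := by
  have h1 : Integrable (fun y : Fin n → ℝ => y i ^ 2) (κ.map G) := by
    rw [h]
    exact integrable_comp_eval (μ := fun _ : Fin n => gaussianReal 0 1) (i := i)
      (f := fun y : ℝ => y ^ 2)
      (memLp_id_gaussianReal 2).integrable_sq
  exact h1.comp_measurable hG

lemma integrable_mul_of_sq {α : Type*} [MeasurableSpace α] {κ : Measure α} {u v : α → ℝ}
    (hu : Measurable u) (hv : Measurable v) (hu2 : Integrable (fun z => u z ^ 2) κ)
    (hv2 : Integrable (fun z => v z ^ 2) κ) : Integrable (fun z => u z * v z) κ :=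
  ((memLp_two_iff_integrable_sq hu.aestronglyMeasurable).2 hu2).integrable_mul
    ((memLp_two_iff_integrable_sq hv.aestronglyMeasurable).2 hv2)

/-- Separation of the first coordinate. -/
noncomputable def splitFirst (n : ℕ) : (Fin (n + 1) → ℝ) ≃ᵐ ℝ × (Fin n → ℝ) :=
  MeasurableEquiv.piFinSuccAbove (fun _ => ℝ) 0

lemma splitFirst_apply (z : Fin (n + 1) → ℝ) : splitFirst n z = (z 0, fun j => z j.succ) := rfl

lemma measurable_comp_splitFirst {β : Type*} [MeasurableSpace β] {u : ℝ × (Fin n → ℝ) → β}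
    (hu : Measurable u) : Measurable fun z : Fin (n + 1) → ℝ => u (z 0, fun j => z j.succ) :=
  hu.comp (splitFirst n).measurable

lemma splitFirst_symm_zero (p : ℝ × (Fin n → ℝ)) : (splitFirst n).symm p 0 = p.1 :=
  congrArg Prod.fst ((splitFirst n).apply_symm_apply p)

lemma splitFirst_symm_succ (p : ℝ × (Fin n → ℝ)) (j : Fin n) :
    (splitFirst n).symm p j.succ = p.2 j :=
  congrFun (congrArg Prod.snd ((splitFirst n).apply_symm_apply p)) j

lemma measurePreserving_splitFirst_withDensity {f₁ : ℝ → ℝ≥0∞} (hf₁ : Measurable f₁)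
    {f₂ : ℝ → (Fin n → ℝ) → ℝ≥0∞} (hf₂ : Measurable (Function.uncurry f₂))
    {K : Kernel ℝ (Fin n → ℝ)} [IsMarkovKernel K] (hK : ∀ x, K x = volume.withDensity (f₂ x))
    [IsProbabilityMeasure (volume.withDensity f₁)]
    {f : (Fin (n + 1) → ℝ) → ℝ≥0∞}
    (h : ∀ᵐ z : Fin (n + 1) → ℝ, f z = f₁ (z 0) * f₂ (z 0) fun j => z j.succ) :
    MeasurePreserving (splitFirst n) (volume.withDensity f) (volume.withDensity f₁ ⊗ₘ K) := by
  refine ⟨(splitFirst n).measurable, Measure.ext_of_lintegral _ fun g hg => ?_⟩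
  have hp : MeasurePreserving (splitFirst n) volume volume :=
    volume_preserving_piFinSuccAbove (fun _ => ℝ) 0
  have hm : Measurable fun p : ℝ × (Fin n → ℝ) => f₁ p.1 * f₂ p.1 p.2 :=
    (hf₁.comp measurable_fst).mul hf₂
  have hm' : Measurable fun z : Fin (n + 1) → ℝ => f₁ (z 0) * f₂ (z 0) fun j => z j.succ :=
    measurable_comp_splitFirst hm
  have hs : ∫⁻ z : Fin (n + 1) → ℝ, (f₁ (z 0) * f₂ (z 0) fun j => z j.succ) *
      g (z 0, fun j => z j.succ) = ∫⁻ p : ℝ × (Fin n → ℝ), f₁ p.1 * f₂ p.1 p.2 * g p :=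
    hp.lintegral_comp (hm.mul hg)
  rw [withDensity_congr_ae h, lintegral_map hg (splitFirst n).measurable,
    Measure.lintegral_compProd hg, lintegral_withDensity_eq_lintegral_mul _ hf₁
      hg.lintegral_kernel_prod_right']
  simp only [splitFirst_apply]
  rw [lintegral_withDensity_eq_lintegral_mul _ hm' (measurable_comp_splitFirst hg)]
  refine hs.trans ?_
  rw [Measure.volume_eq_prod, lintegral_prod (fun p : ℝ × (Fin n → ℝ) => f₁ p.1 * f₂ p.1 p.2 * g p)
    (hm.mul hg).aemeasurable]
  refine lintegral_congr fun x => ?_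
  have hx : Measurable (f₂ x) := hf₂.comp measurable_prodMk_left
  have hgx : Measurable fun w => g (x, w) := hg.comp measurable_prodMk_left
  simp only [Pi.mul_apply, hK, mul_assoc]
  rw [lintegral_withDensity_eq_lintegral_mul _ hx hgx]
  exact lintegral_const_mul _ (hx.mul hgx)

lemma map_prod_compProd {μ : Measure ℝ} [IsProbabilityMeasure μ] [NullSingletonClass μ]
    {K : Kernel ℝ (Fin n → ℝ)} [IsMarkovKernel K] {G₂ : ℝ → (Fin n → ℝ) → Fin n → ℝ}
    (hG₂ : Measurable (Function.uncurry G₂)) (h₂ : ∀ x, (K x).map (G₂ x) = piGaussian n) :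
    (μ ⊗ₘ K).map (fun p => (toGaussian μ p.1, G₂ p.1 p.2)) =
      (gaussianReal 0 1).prod (piGaussian n) := by
  have hg := measurable_toGaussian μ
  have hGp : Measurable fun p : ℝ × (Fin n → ℝ) => (toGaussian μ p.1, G₂ p.1 p.2) :=
    (hg.comp measurable_fst).prodMk hG₂
  refine Measure.ext_of_lintegral _ fun u hu => ?_
  have hu' : Measurable fun p : ℝ × (Fin n → ℝ) => u (toGaussian μ p.1, G₂ p.1 p.2) := hu.comp hGp
  rw [lintegral_map hu hGp, Measure.lintegral_compProd hu',
    lintegral_prod _ hu.aemeasurable, ← map_toGaussian μ,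
    lintegral_map hu.lintegral_prod_right' hg]
  refine lintegral_congr fun x => ?_
  have hx : Measurable fun w => u (toGaussian μ x, w) := hu.comp measurable_prodMk_left
  have hGx : Measurable (G₂ x) := hG₂.comp measurable_prodMk_left
  rw [← h₂ x, lintegral_map hx hGx]

lemma ae_of_measurePreserving_splitFirst {κ : Measure (Fin (n + 1) → ℝ)}
    {ν : Measure (ℝ × (Fin n → ℝ))} (h : MeasurePreserving (splitFirst n) κ ν)
    {p : ℝ × (Fin n → ℝ) → Prop} (hp : ∀ᵐ q ∂ν, p q) :
    ∀ᵐ z ∂κ, p (z 0, fun j => z j.succ) :=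
  h.quasiMeasurePreserving.ae hp

lemma integrable_integral_compProd {α β : Type*} [MeasurableSpace α] [MeasurableSpace β]
    {μ : Measure α} [SFinite μ] {K : Kernel α β} [IsSFiniteKernel K] {u : α × β → ℝ}
    (hu : Integrable u (μ ⊗ₘ K)) : Integrable (fun x => ∫ y, u (x, y) ∂K x) μ :=
  hu.integral_compProd

/-- The inductive step of the Knothe rearrangement: the first coordinate is rearranged by
`toGaussian`, the others by a transport of their conditional law given the first. -/
lemma IsGaussianTransport.cons {f₁ : ℝ → ℝ≥0∞} (hf₁ : Measurable f₁)
    [hμ : IsProbabilityMeasure (volume.withDensity f₁)]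
    {f₂ : ℝ → (Fin n → ℝ) → ℝ≥0∞} (hf₂ : Measurable (Function.uncurry f₂))
    (hprob : ∀ x, IsProbabilityMeasure (volume.withDensity (f₂ x)))
    {G₂ : ℝ → (Fin n → ℝ) → Fin n → ℝ} (hG₂ : Measurable (Function.uncurry G₂))
    {r₂ : ℝ → (Fin n → ℝ) → ℝ} (hr₂ : Measurable (Function.uncurry r₂))
    (h₂ : ∀ x, IsGaussianTransport (f₂ x) (G₂ x) (r₂ x))
    {f : (Fin (n + 1) → ℝ) → ℝ≥0∞}
    (h : ∀ᵐ z : Fin (n + 1) → ℝ, f z = f₁ (z 0) * f₂ (z 0) fun j => z j.succ) :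
    IsGaussianTransport f
      (fun z => (splitFirst n).symm
        (toGaussian (volume.withDensity f₁) (z 0), G₂ (z 0) fun j => z j.succ))
      (fun z => gaussianPDFReal 0 1 (toGaussian (volume.withDensity f₁) (z 0)) / (f₁ (z 0)).toReal +
        r₂ (z 0) fun j => z j.succ) := by
  set μ := volume.withDensity f₁ with hμdef
  let K : Kernel ℝ (Fin n → ℝ) := (Kernel.const ℝ volume).withDensity f₂
  have hK : ∀ x, K x = volume.withDensity (f₂ x) := fun x => by
    rw [Kernel.withDensity_apply _ hf₂, Kernel.const_apply]
  have : IsMarkovKernel K := ⟨fun x => by rw [hK]; exact hprob x⟩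
  have hsp := measurePreserving_splitFirst_withDensity hf₁ hf₂ hK h
  rw [← hμdef] at hsp
  set κ := volume.withDensity f with hκ
  -- The map and the rate in the coordinates `(x, w)`.
  set g := toGaussian μ with hgdef
  have hg : Measurable g := measurable_toGaussian μ
  set r₁ : ℝ → ℝ := fun x => gaussianPDFReal 0 1 (g x) / (f₁ x).toReal with hr₁def
  have hr₁ : Measurable r₁ := ((measurable_gaussianPDFReal 0 1).comp hg).div hf₁.ennreal_toReal
  have hr₁n : ∀ x, 0 ≤ r₁ x := fun x =>
    div_nonneg (gaussianPDFReal_nonneg _ _ _) ENNReal.toReal_nonneg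
  have hGp : Measurable fun p : ℝ × (Fin n → ℝ) => (g p.1, G₂ p.1 p.2) :=
    (hg.comp measurable_fst).prodMk hG₂
  have hmapp := map_prod_compProd (μ := μ) (K := K) hG₂ fun x => by rw [hK, (h₂ x).map_eq]
  have hmeas : Measurable fun z : Fin (n + 1) → ℝ =>
      (splitFirst n).symm (g (z 0), G₂ (z 0) fun j => z j.succ) :=
    (splitFirst n).symm.measurable.comp (measurable_comp_splitFirst hGp)
  have hmap : κ.map (fun z => (splitFirst n).symm (g (z 0), G₂ (z 0) fun j => z j.succ)) =
      piGaussian (n + 1) := by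
    have h1 : κ.map (fun z => (splitFirst n).symm (g (z 0), G₂ (z 0) fun j => z j.succ)) =
        (((κ.map (splitFirst n)).map fun p => (g p.1, G₂ p.1 p.2)).map (splitFirst n).symm) := by
      rw [Measure.map_map hGp (splitFirst n).measurable,
        Measure.map_map (splitFirst n).symm.measurable (hGp.comp (splitFirst n).measurable)]
      rfl
    rw [h1, hsp.map_eq, hmapp]
    exact (measurePreserving_piFinSuccAbove (fun _ : Fin (n + 1) => gaussianReal 0 1) 0).symm.map_eq
  refine ⟨hmeas, (hr₁.comp (measurable_pi_apply 0)).add (measurable_comp_splitFirst hr₂),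
    fun z => add_nonneg (hr₁n _) ((h₂ _).nonneg _), hmap, ?_, ?_⟩
  · have hpos₁ : ∀ᵐ x ∂μ, 0 < (f₁ x).toReal :=
      ae_withDensity_toReal_pos hf₁ (by
        rw [isProbabilityMeasure_withDensity_iff.1 hμ]; exact ENNReal.one_ne_top)
    have hpos₂ : ∀ x, ∀ᵐ w ∂K x, 0 < (f₂ x w).toReal := fun x => by
      rw [hK]
      refine ae_withDensity_toReal_pos (hf₂.comp measurable_prodMk_left) ?_
      rw [isProbabilityMeasure_withDensity_iff.1 (hprob x)]; exact ENNReal.one_ne_top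
    intro l hl
    have hms : MeasurableSet {p : ℝ × (Fin n → ℝ) |
        ∑ i, Real.log (gaussianPDFReal 0 1 (G₂ p.1 p.2 i)) - Real.log (f₂ p.1 p.2).toReal ≤
          l * r₂ p.1 p.2 - n * (1 + Real.log l)} := by
      refine measurableSet_le (Measurable.sub (Finset.measurable_sum _ fun i _ => ?_)
        hf₂.ennreal_toReal.log) ((hr₂.const_mul l).sub_const _)
      exact ((measurable_gaussianPDFReal 0 1).comp ((measurable_pi_apply i).comp hG₂)).log
    have hz₁ := ae_of_measurePreserving_splitFirst hsp (Measure.ae_compProd_of_ae_fst K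
      (measurableSet_lt measurable_const hf₁.ennreal_toReal) hpos₁)
    have hz₂ := ae_of_measurePreserving_splitFirst hsp (Measure.ae_compProd_of_ae_ae
      (measurableSet_lt measurable_const hf₂.ennreal_toReal) (ae_of_all μ hpos₂))
    have hz₃ := ae_of_measurePreserving_splitFirst hsp (Measure.ae_compProd_of_ae_ae hms
      (ae_of_all μ fun x => by simpa only [hK] using (h₂ x).log_le l hl))
    filter_upwards [hz₁, hz₂, hz₃, withDensity_absolutelyContinuous _ _ h] with z h1 h2 h3 hfz
    have hlog := log_sub_log_le (gaussianPDFReal_pos 0 1 (g (z 0)) one_ne_zero) h1 hl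
    simp only [Function.uncurry] at h2
    rw [hfz, ENNReal.toReal_mul, Real.log_mul h1.ne' h2.ne', Fin.sum_univ_succ]
    simp only [splitFirst_symm_zero, splitFirst_symm_succ]
    push_cast
    linarith
  · intro h2m
    -- All second moments are finite, hence so are those of the two factors.
    have hsqp : ∀ {q : ℝ × (Fin n → ℝ) → ℝ}, Integrable (fun z => q (splitFirst n z)) κ →
        Integrable q (μ ⊗ₘ K) := fun hq => by
      rwa [← hsp.integrable_comp_emb (splitFirst n).measurableEmbedding]
    have hsq0 : Integrable (fun p : ℝ × (Fin n → ℝ) => p.1 ^ 2) (μ ⊗ₘ K) := hsqp (h2m 0)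
    have hsq : ∀ j, Integrable (fun p : ℝ × (Fin n → ℝ) => p.2 j ^ 2) (μ ⊗ₘ K) :=
      fun j => hsqp (h2m j.succ)
    have hfst : MeasurePreserving Prod.fst (μ ⊗ₘ K) μ :=
      ⟨measurable_fst, by rw [← Measure.fst, Measure.fst_compProd]⟩
    have hx2 : Integrable (fun x : ℝ => x ^ 2) μ :=
      (hfst.integrable_comp (g := fun x : ℝ => x ^ 2) (by fun_prop)).1 hsq0
    have hw2 : ∀ᵐ x ∂μ, ∀ j, Integrable (fun w : Fin n → ℝ => w j ^ 2) (K x) := by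
      rw [ae_all_iff]
      intro j
      exact ((Measure.integrable_compProd_iff (hsq j).aestronglyMeasurable).1 (hsq j)).1
    obtain ⟨hc₁, hr₁le⟩ := lintegral_gaussianPDFReal_div_le hf₁ hx2
    have hi₁ : Integrable (fun p : ℝ × (Fin n → ℝ) => p.1 * g p.1) (μ ⊗ₘ K) :=
      integrable_mul_of_sq measurable_fst (hg.comp measurable_fst) hsq0
        (hfst.integrable_comp_of_integrable (integrable_toGaussian_sq μ))
    have hmap₂ : (μ ⊗ₘ K).map (fun p => G₂ p.1 p.2) = piGaussian n := by
      have h1 := congrArg Measure.snd hmapp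
      rwa [Measure.snd, Measure.map_map measurable_snd hGp, Measure.snd_prod] at h1
    have hi₂ : Integrable (fun p : ℝ × (Fin n → ℝ) => ∑ j, p.2 j * G₂ p.1 p.2 j) (μ ⊗ₘ K) :=
      integrable_finsetSum _ fun j _ => integrable_mul_of_sq
        ((measurable_pi_apply j).comp measurable_snd) ((measurable_pi_apply j).comp hG₂) (hsq j)
        (integrable_eval_sq_of_map_eq hG₂ hmap₂ j)
    have hc₂ : ∀ᵐ x ∂μ, 0 ≤ ∫ w, ∑ j, w j * G₂ x w j ∂K x ∧
        ∫⁻ w, ENNReal.ofReal (r₂ x w) ∂K x ≤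
          ENNReal.ofReal (∫ w, ∑ j, w j * G₂ x w j ∂K x) := by
      filter_upwards [hw2] with x hx
      have := (h₂ x).moment (by rwa [← hK])
      rwa [← hK] at this
    have hmean : ∫ z, ∑ i, z i * (splitFirst n).symm (g (z 0), G₂ (z 0) fun j => z j.succ) i ∂κ =
        ∫ x, x * g x ∂μ + ∫ x, ∫ w, ∑ j, w j * G₂ x w j ∂K x ∂μ := by
      simp only [Fin.sum_univ_succ, splitFirst_symm_zero, splitFirst_symm_succ]
      refine (hsp.integral_comp' (f := splitFirst n)
        fun p => p.1 * g p.1 + ∑ j, p.2 j * G₂ p.1 p.2 j).trans ?_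
      rw [integral_add hi₁ hi₂, Measure.integral_compProd hi₁, Measure.integral_compProd hi₂]
      simp
    have hrate : ∫⁻ z, ENNReal.ofReal (r₁ (z 0) + r₂ (z 0) fun j => z j.succ) ∂κ =
        ∫⁻ x, ENNReal.ofReal (r₁ x) ∂μ + ∫⁻ x, ∫⁻ w, ENNReal.ofReal (r₂ x w) ∂K x ∂μ := by
      have hm₁ : Measurable fun p : ℝ × (Fin n → ℝ) => ENNReal.ofReal (r₁ p.1) :=
        (hr₁.comp measurable_fst).ennreal_ofReal
      have hm₂ : Measurable fun p : ℝ × (Fin n → ℝ) => ENNReal.ofReal (r₂ p.1 p.2) :=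
        hr₂.ennreal_ofReal
      simp only [fun z : Fin (n + 1) → ℝ =>
        ENNReal.ofReal_add (hr₁n (z 0)) ((h₂ (z 0)).nonneg fun j => z j.succ)]
      have := hsp.lintegral_comp (hm₁.add hm₂)
      refine this.trans ?_
      rw [Measure.lintegral_compProd (hm₁.add hm₂), ← lintegral_add_left hr₁.ennreal_ofReal]
      refine lintegral_congr fun x => ?_
      simp only [Pi.add_apply]
      rw [lintegral_add_left measurable_const]
      simp
    have hc₂0 : 0 ≤ᵐ[μ] fun x => ∫ w, ∑ j, w j * G₂ x w j ∂K x := by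
      filter_upwards [hc₂] with x hx using hx.1
    rw [hmean, hrate]
    refine ⟨add_nonneg hc₁ (integral_nonneg_of_ae hc₂0), ?_⟩
    rw [ENNReal.ofReal_add hc₁ (integral_nonneg_of_ae hc₂0),
      ofReal_integral_eq_lintegral_ofReal (integrable_integral_compProd hi₂) hc₂0]
    refine add_le_add hr₁le (lintegral_mono_ae ?_)
    filter_upwards [hc₂] with x hx using hx.2

lemma IsGaussianTransport.zero {f : (Fin 0 → ℝ) → ℝ≥0∞}
    (h : IsProbabilityMeasure (volume.withDensity f)) :
    IsGaussianTransport f (fun z => z) (fun _ => 0) := by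
  refine ⟨measurable_id, measurable_const, fun _ => le_rfl, ?_, ?_, ?_⟩
  · rw [Measure.map_id']
    refine Measure.ext fun s _ => ?_
    rcases s.eq_empty_or_nonempty with rfl | hs
    · simp
    · rw [Subsingleton.eq_univ_of_nonempty hs, measure_univ, measure_univ]
  · have h1 : ∀ z, f z = 1 := fun z => by
      have := isProbabilityMeasure_withDensity_iff.1 h
      rw [Measure.volume_pi_eq_dirac z, lintegral_dirac] at this
      exact this
    simp [h1]
  · simp

/-- The Knothe rearrangement, with measurable dependence on a parameter: a measurable family of
densities on `Fin n → ℝ` is carried to the standard Gaussian law by a measurable family of maps. -/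
theorem exists_isGaussianTransport (n : ℕ) : ∀ {τ : Type*} [MeasurableSpace τ]
    (f : τ → (Fin n → ℝ) → ℝ≥0∞), Measurable (Function.uncurry f) →
    (∀ t, IsProbabilityMeasure (volume.withDensity (f t))) →
    ∃ (G : τ → (Fin n → ℝ) → Fin n → ℝ) (r : τ → (Fin n → ℝ) → ℝ),
      Measurable (Function.uncurry G) ∧ Measurable (Function.uncurry r) ∧
      ∀ t, IsGaussianTransport (f t) (G t) (r t) := by
  induction n with
  | zero =>
    intro τ _ f hf h1
    exact ⟨fun _ z => z, fun _ _ => 0, measurable_snd, measurable_const, fun t => .zero (h1 t)⟩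
  | succ n ih =>
    intro τ _ f hf h1
    set F : τ → ℝ × (Fin n → ℝ) → ℝ≥0∞ := fun t p => f t ((splitFirst n).symm p) with hF
    have hFm : Measurable fun q : τ × ℝ × (Fin n → ℝ) => F q.1 q.2 :=
      hf.comp (measurable_fst.prodMk ((splitFirst n).symm.measurable.comp measurable_snd))
    have hFm' : Measurable fun q : (τ × ℝ) × (Fin n → ℝ) => F q.1.1 (q.1.2, q.2) :=
      hFm.comp (measurable_fst.fst.prodMk (measurable_fst.snd.prodMk measurable_snd))
    have hp : MeasurePreserving (splitFirst n) volume volume :=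
      volume_preserving_piFinSuccAbove (fun _ => ℝ) 0
    set f₁ : τ → ℝ → ℝ≥0∞ := fun t x => ∫⁻ w, F t (x, w) with hf₁def
    have hf₁ : Measurable (Function.uncurry f₁) := hFm'.lintegral_prod_right'
    -- The conditional density is defined arbitrarily where the marginal density is degenerate.
    set f₂ : τ × ℝ → (Fin n → ℝ) → ℝ≥0∞ := fun q w =>
      if f₁ q.1 q.2 = 0 ∨ f₁ q.1 q.2 = ∞ then ∏ i, gaussianPDF 0 1 (w i)
      else F q.1 (q.2, w) / f₁ q.1 q.2 with hf₂def
    have hf₂ : Measurable (Function.uncurry f₂) := by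
      refine Measurable.ite ?_ ((measurable_prod_gaussianPDF n).comp measurable_snd)
        (hFm'.div (hf₁.comp measurable_fst))
      have hm : Measurable fun q : (τ × ℝ) × (Fin n → ℝ) => f₁ q.1.1 q.1.2 :=
        hf₁.comp measurable_fst
      exact (hm (measurableSet_singleton 0)).union (hm (measurableSet_singleton ∞))
    have hprob₁ : ∀ t, IsProbabilityMeasure (volume.withDensity (f₁ t)) := fun t => by
      have hFt : Measurable (F t) := hFm.comp measurable_prodMk_left
      rw [isProbabilityMeasure_withDensity_iff, ← isProbabilityMeasure_withDensity_iff.1 (h1 t)]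
      calc ∫⁻ x, f₁ t x = ∫⁻ p, F t p := by
            rw [Measure.volume_eq_prod, lintegral_prod _ hFt.aemeasurable]
        _ = ∫⁻ z, F t (splitFirst n z) := (hp.lintegral_comp hFt).symm
        _ = ∫⁻ z, f t z := by simp [hF]
    have hprob₂ : ∀ q, IsProbabilityMeasure (volume.withDensity (f₂ q)) := fun q => by
      rw [isProbabilityMeasure_withDensity_iff]
      by_cases h : f₁ q.1 q.2 = 0 ∨ f₁ q.1 q.2 = ∞
      · simp only [hf₂def, if_pos h, lintegral_prod_gaussianPDF]
      · have hFq : Measurable fun w => F q.1 (q.2, w) := hFm'.comp (measurable_prodMk_left (x := q))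
        simp only [hf₂def, if_neg h, div_eq_mul_inv]
        rw [lintegral_mul_const _ hFq]
        push Not at h
        exact ENNReal.mul_inv_cancel h.1 h.2
    obtain ⟨G₂, r₂, hG₂, hr₂, h₂⟩ := ih f₂ hf₂ hprob₂
    have hsplit : Measurable fun q : τ × (Fin (n + 1) → ℝ) =>
        ((q.1, q.2 0), fun j : Fin n => q.2 j.succ) := by
      refine (measurable_fst.prodMk ((measurable_pi_apply 0).comp measurable_snd)).prodMk ?_
      exact measurable_pi_lambda _ fun j => (measurable_pi_apply _).comp measurable_snd
    have hcdf : Measurable fun q : τ × ℝ => toGaussian (volume.withDensity (f₁ q.1)) q.2 :=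
      measurable_probit.comp (measurable_cdf_withDensity hf₁ hprob₁)
    refine ⟨fun t z => (splitFirst n).symm
        (toGaussian (volume.withDensity (f₁ t)) (z 0), G₂ (t, z 0) fun j => z j.succ),
      fun t z => gaussianPDFReal 0 1 (toGaussian (volume.withDensity (f₁ t)) (z 0)) /
        (f₁ t (z 0)).toReal + r₂ (t, z 0) fun j => z j.succ, ?_, ?_, fun t => ?_⟩
    · exact (splitFirst n).symm.measurable.comp
        ((hcdf.comp hsplit.fst).prodMk (hG₂.comp hsplit))
    · exact ((((measurable_gaussianPDFReal 0 1).comp hcdf).div hf₁.ennreal_toReal).comp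
        hsplit.fst).add (hr₂.comp hsplit)
    · have := hprob₁ t
      have hf₁t : Measurable (f₁ t) := hf₁.comp measurable_prodMk_left
      have htx : Measurable fun p : ℝ × (Fin n → ℝ) => ((t, p.1), p.2) :=
        (measurable_const.prodMk measurable_fst).prodMk measurable_snd
      refine IsGaussianTransport.cons hf₁t (f₂ := fun x => f₂ (t, x)) (hf₂.comp htx)
        (fun x => hprob₂ _) (G₂ := fun x => G₂ (t, x)) (hG₂.comp htx)
        (r₂ := fun x => r₂ (t, x)) (hr₂.comp htx) (fun x => h₂ _) ?_
      have hFt : Measurable (F t) := hFm.comp measurable_prodMk_left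
      have hae : ∀ᵐ p : ℝ × (Fin n → ℝ), F t p = f₁ t p.1 * f₂ (t, p.1) p.2 := by
        have hms : MeasurableSet {p : ℝ × (Fin n → ℝ) | F t p = f₁ t p.1 * f₂ (t, p.1) p.2} :=
          measurableSet_eq_fun hFt ((hf₁t.comp measurable_fst).mul (hf₂.comp htx))
        rw [Measure.volume_eq_prod, Measure.ae_prod_iff_ae_ae hms]
        have hfin : ∀ᵐ x, f₁ t x < ∞ := ae_lt_top hf₁t (by
          rw [isProbabilityMeasure_withDensity_iff.1 (hprob₁ t)]; exact ENNReal.one_ne_top)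
        filter_upwards [hfin] with x hx
        have hFx : Measurable fun w => F t (x, w) := hFt.comp measurable_prodMk_left
        rcases eq_or_ne (f₁ t x) 0 with h0 | h0
        · filter_upwards [(lintegral_eq_zero_iff hFx).1 h0] with w hw
          rw [h0, zero_mul]; exact hw
        · refine ae_of_all _ fun w => ?_
          simp only [hf₂def, h0, hx.ne, or_self, if_false]
          rw [ENNReal.mul_div_cancel h0 hx.ne]
      have := ae_of_measurePreserving_splitFirst hp hae
      filter_upwards [this] with z hz
      rw [← hz]
      exact congrArg (f t) ((splitFirst n).symm_apply_apply z).symm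

end Knothe

/-! ### The Gaussian channel -/

section Mehler

/-- The density of `N(ρ a, v)` with respect to `N(0, 1)`. For `v = 1 - ρ ^ 2` this is the Mehler
kernel. -/
noncomputable def mehler (ρ : ℝ) (v : ℝ≥0) (a y : ℝ) : ℝ≥0∞ :=
  gaussianPDF (ρ * a) v y / gaussianPDF 0 1 y

variable {ρ : ℝ} {v : ℝ≥0}

lemma measurable_mehler : Measurable (Function.uncurry (mehler ρ v)) := by
  have h1 : Measurable fun p : ℝ × ℝ => gaussianPDF (ρ * p.1) v p.2 :=
    measurable_uncurry_gaussianPDF.comp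
      ((measurable_fst.const_mul ρ).prodMk (measurable_const.prodMk measurable_snd))
  exact h1.div ((measurable_gaussianPDF 0 1).comp measurable_snd)

lemma measurable_mehler_comp {β : Type*} [MeasurableSpace β] {a b : β → ℝ} (ha : Measurable a)
    (hb : Measurable b) : Measurable fun x => mehler ρ v (a x) (b x) := by
  have h := (measurable_mehler (ρ := ρ) (v := v)).comp (ha.prodMk hb)
  exact h

lemma mehler_eq_exp (hv : v ≠ 0) (a y : ℝ) : mehler ρ v a y =
    ENNReal.ofReal (Real.exp (-(Real.log v) / 2 + y ^ 2 / 2 - (y - ρ * a) ^ 2 / (2 * v))) := by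
  have hv' : (0 : ℝ) < v := by positivity
  rw [mehler, gaussianPDF, gaussianPDF,
    ← ENNReal.ofReal_div_of_pos (gaussianPDFReal_pos 0 1 y one_ne_zero)]
  congr 1
  have hs : Real.exp (-(Real.log v) / 2) = (√(v : ℝ))⁻¹ := by
    rw [Real.sqrt_eq_rpow, ← Real.rpow_neg hv'.le, Real.rpow_def_of_pos hv']
    ring_nf
  rw [gaussianPDFReal, gaussianPDFReal, sub_eq_add_neg (-Real.log v / 2 + y ^ 2 / 2), Real.exp_add,
    Real.exp_add, hs, NNReal.coe_one, mul_one, sub_zero, Real.sqrt_mul (by positivity) (v : ℝ), mul_inv,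
    div_eq_mul_inv, mul_inv, inv_inv, ← Real.exp_neg]
  have h2 : √(2 * Real.pi) ≠ 0 := by positivity
  field_simp

lemma mehler_comm (hv : v ≠ 0) (h : ρ ^ 2 + v = 1) (a y : ℝ) :
    mehler ρ v a y = mehler ρ v y a := by
  rw [mehler_eq_exp hv, mehler_eq_exp hv]
  congr 2
  have hv' : (v : ℝ) ≠ 0 := by exact_mod_cast hv
  field_simp
  linear_combination (y ^ 2 - a ^ 2) * h

lemma withDensity_mehler (hv : v ≠ 0) (a : ℝ) :
    (gaussianReal 0 1).withDensity (mehler ρ v a) = gaussianReal (ρ * a) v := by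
  have hm : Measurable (mehler ρ v a) := measurable_mehler_comp measurable_const measurable_id
  rw [gaussianReal_of_var_ne_zero 0 one_ne_zero, gaussianReal_of_var_ne_zero _ hv,
    ← withDensity_mul _ (measurable_gaussianPDF 0 1) hm]
  congr 1
  ext y
  exact ENNReal.mul_div_cancel (gaussianPDF_pos 0 one_ne_zero y).ne' gaussianPDF_ne_top

/-- The density of `N(ρ u, v I)` with respect to `N(0, I)` on `Fin n → ℝ`. -/
noncomputable def piMehler (n : ℕ) (ρ : ℝ) (v : ℝ≥0) (u y : Fin n → ℝ) : ℝ≥0∞ :=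
  ∏ i, mehler ρ v (u i) (y i)

variable {n : ℕ}

lemma measurable_piMehler_comp {β : Type*} [MeasurableSpace β] {a b : β → Fin n → ℝ}
    (ha : Measurable a) (hb : Measurable b) : Measurable fun x => piMehler n ρ v (a x) (b x) :=
  Finset.measurable_prod _ fun i _ =>
    measurable_mehler_comp (measurable_pi_iff.1 ha i) (measurable_pi_iff.1 hb i)

lemma measurable_affine {β : Type*} [MeasurableSpace β] {a b : β → Fin n → ℝ} {σ : ℝ}
    (ha : Measurable a) (hb : Measurable b) : Measurable fun x i => ρ * a x i + σ * b x i :=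
  measurable_pi_lambda _ fun i =>
    ((measurable_pi_iff.1 ha i).const_mul ρ).add ((measurable_pi_iff.1 hb i).const_mul σ)

lemma map_affine_piGaussian (hv : v ≠ 0) {σ : ℝ} (hσ : σ ^ 2 = v) (u : Fin n → ℝ) :
    (piGaussian n).map (fun w i => ρ * u i + σ * w i) =
      (piGaussian n).withDensity (piMehler n ρ v u) := by
  have h1 : ∀ i, (gaussianReal 0 1).map (fun w => ρ * u i + σ * w) = gaussianReal (ρ * u i) v := by
    intro i
    have : (fun w : ℝ => ρ * u i + σ * w) = (fun x => ρ * u i + x) ∘ fun w => σ * w := rfl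
    rw [this, ← Measure.map_map (by fun_prop) (by fun_prop), gaussianReal_map_const_mul,
      gaussianReal_map_const_add]
    congr 1
    · ring
    · ext; simp [hσ]
  have h2 : ∀ i, IsFiniteMeasure ((gaussianReal 0 1).withDensity (mehler ρ v (u i))) := fun i => by
    rw [withDensity_mehler hv]; infer_instance
  have h3 := pi_withDensity (fun _ : Fin n => gaussianReal 0 1) (fun i => mehler ρ v (u i))
    fun i => measurable_mehler_comp measurable_const measurable_id
  have h4 : ∀ i, SigmaFinite ((gaussianReal 0 1).map fun w => ρ * u i + σ * w) := fun i => by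
    rw [h1]; infer_instance
  have h5 := Measure.pi_map_pi (μ := fun _ : Fin n => gaussianReal 0 1)
    (f := fun i w => ρ * u i + σ * w) (fun i => by fun_prop)
  rw [piGaussian, h5]
  simp only [h1]
  rw [show piMehler n ρ v u = fun x => ∏ i, mehler ρ v (u i) (x i) from rfl, ← h3]
  simp only [withDensity_mehler hv]

lemma lintegral_piMehler (hv : v ≠ 0) {σ : ℝ} (hσ : σ ^ 2 = v) (u : Fin n → ℝ) :
    ∫⁻ y, piMehler n ρ v u y ∂piGaussian n = 1 := by
  rw [← isProbabilityMeasure_withDensity_iff, ← map_affine_piGaussian hv hσ]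
  exact Measure.isProbabilityMeasure_map
    (measurable_affine measurable_const measurable_id).aemeasurable

lemma piMehler_comm (hv : v ≠ 0) (h : ρ ^ 2 + v = 1) (u y : Fin n → ℝ) :
    piMehler n ρ v u y = piMehler n ρ v y u :=
  Finset.prod_congr rfl fun _ _ => mehler_comm hv h _ _

lemma log_toReal_piMehler (hv : v ≠ 0) (u y : Fin n → ℝ) : Real.log (piMehler n ρ v u y).toReal =
    ∑ i, (-(Real.log v) / 2 + y i ^ 2 / 2 - (y i - ρ * u i) ^ 2 / (2 * v)) := by
  simp only [piMehler, mehler_eq_exp hv]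
  rw [ENNReal.toReal_prod, Real.log_prod fun i _ => ?_]
  · refine Finset.sum_congr rfl fun i _ => ?_
    rw [ENNReal.toReal_ofReal (Real.exp_pos _).le, Real.log_exp]
  · rw [ENNReal.toReal_ofReal (Real.exp_pos _).le]
    exact (Real.exp_pos _).ne'

end Mehler

section Coupling

variable {α : Type*} [MeasurableSpace α] {n : ℕ} {ρ σ : ℝ} {v : ℝ≥0}

lemma integral_eval_sq_of_map_eq {κ : Measure α} {G : α → Fin n → ℝ} (hG : Measurable G)
    (h : κ.map G = piGaussian n) (i : Fin n) : ∫ z, G z i ^ 2 ∂κ = 1 := by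
  have h1 := integral_map (μ := κ) hG.aemeasurable (f := fun y : Fin n → ℝ => y i ^ 2)
    ((measurable_pi_apply i).pow_const 2).aestronglyMeasurable
  rw [← h1, h, integral_comp_eval (μ := fun _ : Fin n => gaussianReal 0 1) (i := i)
    (f := fun y : ℝ => y ^ 2) (by fun_prop)]
  have := variance_of_integral_eq_zero (X := fun x : ℝ => x) (μ := gaussianReal 0 1)
    (by fun_prop) integral_id_gaussianReal
  rw [← this, variance_fun_id_gaussianReal]
  rfl

/-- The noisy image `(Z, ρ G(Z) + σ W)` of `Z`, with `W` a standard Gaussian independent of `Z`. -/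
noncomputable def noisy (ρ σ : ℝ) (G : α → Fin n → ℝ) (p : α × (Fin n → ℝ)) :
    α × (Fin n → ℝ) :=
  (p.1, fun i => ρ * G p.1 i + σ * p.2 i)

lemma measurable_noisy {G : α → Fin n → ℝ} (hG : Measurable G) : Measurable (noisy ρ σ G) :=
  measurable_fst.prodMk (measurable_affine (hG.comp measurable_fst) measurable_snd)

variable {κ : Measure α} {G : α → Fin n → ℝ}

lemma fst_map_noisy (hG : Measurable G) :
    ((κ.prod (piGaussian n)).map (noisy ρ σ G)).fst = κ := by
  rw [Measure.fst, Measure.map_map measurable_fst (measurable_noisy hG)]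
  exact Measure.fst_prod

lemma map_noisy_eq_withDensity (hv : v ≠ 0) (hσ : σ ^ 2 = v) (hG : Measurable G) :
    (κ.prod (piGaussian n)).map (noisy ρ σ G) =
      (κ.prod (piGaussian n)).withDensity fun p => piMehler n ρ v (G p.1) p.2 := by
  have hD : Measurable fun p : α × (Fin n → ℝ) => piMehler n ρ v (G p.1) p.2 :=
    measurable_piMehler_comp (hG.comp measurable_fst) measurable_snd
  refine Measure.ext_of_lintegral _ fun g hg => ?_
  rw [lintegral_map hg (measurable_noisy hG), lintegral_withDensity_eq_lintegral_mul _ hD hg,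
    lintegral_prod (fun p => g (noisy ρ σ G p)) (hg.comp (measurable_noisy hG)).aemeasurable,
    lintegral_prod _ (hD.mul hg).aemeasurable]
  refine lintegral_congr fun z => ?_
  have hgz : Measurable fun y => g (z, y) := hg.comp measurable_prodMk_left
  have hDz : Measurable (piMehler n ρ v (G z)) :=
    measurable_piMehler_comp measurable_const measurable_id
  have := lintegral_map (μ := piGaussian n) hgz
    (measurable_affine (ρ := ρ) (σ := σ) (measurable_const (a := G z)) measurable_id)
  simp only [id_eq] at this
  rw [map_affine_piGaussian hv hσ,
    lintegral_withDensity_eq_lintegral_mul _ hDz hgz] at this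
  exact this.symm

/-- The noisy image is again standard Gaussian, by the symmetry of the Mehler kernel. -/
lemma snd_map_noisy [SFinite κ] (hv : v ≠ 0) (hσ : σ ^ 2 = v) (h : ρ ^ 2 + v = 1) (hG : Measurable G)
    (hmap : κ.map G = piGaussian n) :
    ((κ.prod (piGaussian n)).map (noisy ρ σ G)).snd = piGaussian n := by
  have hD : Measurable fun p : α × (Fin n → ℝ) => piMehler n ρ v (G p.1) p.2 :=
    measurable_piMehler_comp (hG.comp measurable_fst) measurable_snd
  rw [map_noisy_eq_withDensity hv hσ hG]
  refine Measure.ext_of_lintegral _ fun g hg => ?_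
  have hg' : Measurable fun p : α × (Fin n → ℝ) => g p.2 := hg.comp measurable_snd
  rw [Measure.snd, lintegral_map hg measurable_snd, lintegral_withDensity_eq_lintegral_mul _ hD hg',
    lintegral_prod_symm _ (hD.mul hg').aemeasurable]
  refine lintegral_congr fun y => ?_
  have hDy : Measurable fun z => piMehler n ρ v (G z) y :=
    measurable_piMehler_comp hG measurable_const
  simp only [Pi.mul_apply]
  rw [lintegral_mul_const _ hDy]
  have hy : Measurable fun u : Fin n → ℝ => piMehler n ρ v u y :=
    measurable_piMehler_comp measurable_id measurable_const
  have h1 : ∫⁻ z, piMehler n ρ v (G z) y ∂κ = 1 := by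
    rw [← lintegral_map hy hG, hmap]
    simp only [fun u => piMehler_comm hv h u y]
    exact lintegral_piMehler hv hσ y
  rw [h1, one_mul]

/-- The mutual information of the Gaussian channel at correlation `ρ`. -/
lemma mutualInfo_map_noisy {κ : Measure α} [IsProbabilityMeasure κ] (hv : v ≠ 0)
    (hσ : σ ^ 2 = v) (h : ρ ^ 2 + v = 1) (hG : Measurable G)
    (hmap : κ.map G = piGaussian n) :
    mutualInfo ((κ.prod (piGaussian n)).map (noisy ρ σ G)) =
      ENNReal.ofReal (-(n * Real.log v) / 2) := by
  have hv' : (v : ℝ) ≠ 0 := by exact_mod_cast hv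
  have hN := measurable_noisy (ρ := ρ) (σ := σ) hG
  have hD : Measurable fun p : α × (Fin n → ℝ) => piMehler n ρ v (G p.1) p.2 :=
    measurable_piMehler_comp (hG.comp measurable_fst) measurable_snd
  rw [mutualInfo, fst_map_noisy hG, snd_map_noisy hv hσ h hG hmap]
  set η := κ.prod (piGaussian n) with hη
  set ν := η.map (noisy ρ σ G) with hν
  have hνD : ν = η.withDensity fun p => piMehler n ρ v (G p.1) p.2 :=
    map_noisy_eq_withDensity hv hσ hG
  have : IsProbabilityMeasure ν := Measure.isProbabilityMeasure_map hN.aemeasurable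
  have hac : ν ≪ η := hνD ▸ withDensity_absolutelyContinuous _ _
  have hllr : llr ν η =ᵐ[ν] fun p =>
      ∑ i, (-(Real.log v) / 2 + p.2 i ^ 2 / 2 - (p.2 i - ρ * G p.1 i) ^ 2 / (2 * v)) := by
    have h1 : ν.rnDeriv η =ᵐ[η] fun p => piMehler n ρ v (G p.1) p.2 := by
      rw [hνD]; exact Measure.rnDeriv_withDensity _ hD
    filter_upwards [hac.ae_le h1] with p hp
    rw [llr, hp, log_toReal_piMehler hv]
  have hsnd : ν.map Prod.snd = piGaussian n := snd_map_noisy hv hσ h hG hmap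
  have hW : η.map Prod.snd = piGaussian n := Measure.snd_prod
  have hGm : ∀ i, Measurable fun p : α × (Fin n → ℝ) => G p.1 i := fun i =>
    (measurable_pi_iff.1 hG i).comp measurable_fst
  have hi₁ : ∀ i, Integrable (fun p : α × (Fin n → ℝ) => p.2 i ^ 2 / 2) ν := fun i =>
    (integrable_eval_sq_of_map_eq measurable_snd hsnd i).div_const 2
  have hm₂ : ∀ i, Measurable fun p : α × (Fin n → ℝ) => (p.2 i - ρ * G p.1 i) ^ 2 / (2 * v) :=
    fun i => (((measurable_pi_iff.1 measurable_snd i).sub ((hGm i).const_mul ρ)).pow_const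
      2).div_const _
  have hcomp : ∀ i (p : α × (Fin n → ℝ)),
      ((noisy ρ σ G p).2 i - ρ * G (noisy ρ σ G p).1 i) ^ 2 / (2 * v) = p.2 i ^ 2 / 2 := by
    intro i p
    simp only [noisy]
    rw [add_sub_cancel_left, mul_pow, hσ]
    field_simp
  have hi₂ : ∀ i, Integrable (fun p => (p.2 i - ρ * G p.1 i) ^ 2 / (2 * v)) ν := fun i => by
    rw [hν, integrable_map_measure (hm₂ i).aestronglyMeasurable hN.aemeasurable]
    refine ((integrable_eval_sq_of_map_eq measurable_snd hW i).div_const 2).congr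
      (ae_of_all _ fun p => (hcomp i p).symm)
  have hI₁ : ∀ i, ∫ p, p.2 i ^ 2 / 2 ∂ν = 1 / 2 := fun i => by
    rw [integral_div, integral_eval_sq_of_map_eq measurable_snd hsnd i]
  have hI₂ : ∀ i, ∫ p, (p.2 i - ρ * G p.1 i) ^ 2 / (2 * v) ∂ν = 1 / 2 := fun i => by
    rw [hν, integral_map hN.aemeasurable (hm₂ i).aestronglyMeasurable]
    simp only [hcomp]
    rw [integral_div, integral_eval_sq_of_map_eq measurable_snd hW i]
  have hic : Integrable (fun _ : α × (Fin n → ℝ) => -(Real.log v) / 2) ν := integrable_const _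
  have hit : ∀ i ∈ Finset.univ, Integrable (fun p => -(Real.log v) / 2 + p.2 i ^ 2 / 2 -
      (p.2 i - ρ * G p.1 i) ^ 2 / (2 * v)) ν := fun i _ => (hic.add (hi₁ i)).sub (hi₂ i)
  have hint : Integrable (llr ν η) ν := by
    rw [integrable_congr hllr]
    exact integrable_finsetSum _ hit
  have hterm : ∀ i : Fin n, ∫ p, (-(Real.log v) / 2 + p.2 i ^ 2 / 2 -
      (p.2 i - ρ * G p.1 i) ^ 2 / (2 * v)) ∂ν = -(Real.log v) / 2 := fun i => by
    have ha : Integrable (fun p : α × (Fin n → ℝ) => -(Real.log v) / 2 + p.2 i ^ 2 / 2) ν :=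
      hic.add (hi₁ i)
    rw [integral_sub ha (hi₂ i), integral_add hic (hi₁ i), hI₁, hI₂]
    simp
  rw [InformationTheory.klDiv_of_ac_of_integrable hac hint, integral_congr_ae hllr,
    integral_finsetSum _ hit]
  simp only [hterm, Finset.sum_const, Finset.card_univ, Fintype.card_fin, nsmul_eq_mul,
    probReal_univ]
  congr 1
  ring

/-- Mutual information does not increase when both variables are mapped. -/
lemma mutualInfo_map_le {Ω Ω' Ξ Ξ' : Type*} [MeasurableSpace Ω] [MeasurableSpace Ω']
    [MeasurableSpace Ξ] [MeasurableSpace Ξ'] (P : Measure (Ω × Ω')) [IsProbabilityMeasure P]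
    {a : Ω → Ξ} {b : Ω' → Ξ'} (ha : Measurable a) (hb : Measurable b) :
    mutualInfo (P.map (Prod.map a b)) ≤ mutualInfo P := by
  have h1 : (P.map (Prod.map a b)).fst = P.fst.map a := by
    rw [Measure.fst, Measure.fst, Measure.map_map measurable_fst (ha.prodMap hb),
      Measure.map_map ha measurable_fst]
    rfl
  have h2 : (P.map (Prod.map a b)).snd = P.snd.map b := by
    rw [Measure.snd, Measure.snd, Measure.map_map measurable_snd (ha.prodMap hb),
      Measure.map_map hb measurable_snd]
    rfl
  rw [mutualInfo, mutualInfo, h1, h2, Measure.map_prod_map _ _ ha hb]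
  exact InformationTheory.klDiv_map_le _ _ (ha.prodMap hb)

/-- The transport cost of the noisy image. -/
lemma integral_sq_sub_noisy {n : ℕ} {κ : Measure (Fin n → ℝ)} [IsProbabilityMeasure κ]
    {G : (Fin n → ℝ) → Fin n → ℝ} (hv : v ≠ 0) (hσ : σ ^ 2 = v) (h : ρ ^ 2 + v = 1)
    (hG : Measurable G) (hmap : κ.map G = piGaussian n)
    (h2 : ∀ i, Integrable (fun z : Fin n → ℝ => z i ^ 2) κ) :
    Integrable (fun p : (Fin n → ℝ) × (Fin n → ℝ) => ∑ i, (p.1 i - p.2 i) ^ 2)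
      ((κ.prod (piGaussian n)).map (noisy ρ σ G)) ∧
    ∫ p, ∑ i, (p.1 i - p.2 i) ^ 2 ∂(κ.prod (piGaussian n)).map (noisy ρ σ G) =
      ∫ z, ∑ i, z i ^ 2 ∂κ + n - 2 * ρ * ∫ z, ∑ i, z i * G z i ∂κ := by
  have hN := measurable_noisy (ρ := ρ) (σ := σ) hG
  set η := κ.prod (piGaussian n) with hη
  set ν := η.map (noisy ρ σ G) with hν
  have hfst : ν.map Prod.fst = κ := fst_map_noisy hG
  have hsnd : ν.map Prod.snd = piGaussian n := snd_map_noisy hv hσ h hG hmap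
  have hm₁ : ∀ i, Measurable fun p : (Fin n → ℝ) × (Fin n → ℝ) => p.1 i := fun i =>
    measurable_pi_iff.1 measurable_fst i
  have hm₂ : ∀ i, Measurable fun p : (Fin n → ℝ) × (Fin n → ℝ) => p.2 i := fun i =>
    measurable_pi_iff.1 measurable_snd i
  have hGi : ∀ i, Measurable fun z => G z i := measurable_pi_iff.1 hG
  have hi₁ : ∀ i, Integrable (fun p : (Fin n → ℝ) × (Fin n → ℝ) => p.1 i ^ 2) ν := fun i => by
    have := h2 i
    rw [← hfst] at this
    exact this.comp_measurable measurable_fst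
  have hi₂ : ∀ i, Integrable (fun p : (Fin n → ℝ) × (Fin n → ℝ) => p.2 i ^ 2) ν := fun i =>
    integrable_eval_sq_of_map_eq measurable_snd hsnd i
  have hi₃ : ∀ i, Integrable (fun p : (Fin n → ℝ) × (Fin n → ℝ) => p.1 i * p.2 i) ν := fun i =>
    integrable_mul_of_sq (hm₁ i) (hm₂ i) (hi₁ i) (hi₂ i)
  have hzG : ∀ i, Integrable (fun z => z i * G z i) κ := fun i =>
    integrable_mul_of_sq (measurable_pi_apply i) (hGi i) (h2 i)
      (integrable_eval_sq_of_map_eq hG hmap i)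
  have hI₁ : ∀ i, ∫ p, p.1 i ^ 2 ∂ν = ∫ z, z i ^ 2 ∂κ := fun i => by
    have := integral_map (μ := ν) measurable_fst.aemeasurable
      (f := fun z : Fin n → ℝ => z i ^ 2)
      ((measurable_pi_apply i).pow_const 2).aestronglyMeasurable
    rw [hfst] at this
    exact this.symm
  have hI₂ : ∀ i, ∫ p, p.2 i ^ 2 ∂ν = 1 := integral_eval_sq_of_map_eq measurable_snd hsnd
  have hI₃ : ∀ i, ∫ p, p.1 i * p.2 i ∂ν = ρ * ∫ z, z i * G z i ∂κ := fun i => by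
    have hz : Integrable (fun z : Fin n → ℝ => z i) κ :=
      ((memLp_two_iff_integrable_sq (measurable_pi_apply i).aestronglyMeasurable).2
        (h2 i)).integrable one_le_two
    have hw : Integrable (fun w : Fin n → ℝ => w i) (piGaussian n) :=
      integrable_eval (μ := fun _ : Fin n => gaussianReal 0 1) (i := i)
        (IsGaussian.integrable_id (μ := gaussianReal 0 1))
    have hw0 : ∫ w : Fin n → ℝ, w i ∂piGaussian n = 0 := by
      rw [piGaussian, integral_eval (μ := fun _ : Fin n => gaussianReal 0 1) (i := i),
        integral_id_gaussianReal]
    have e : ∀ p : (Fin n → ℝ) × (Fin n → ℝ), (noisy ρ σ G p).1 i * (noisy ρ σ G p).2 i =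
        ρ * (p.1 i * G p.1 i) + σ * (p.1 i * p.2 i) := fun p => by
      simp only [noisy]; ring
    have hm : Measurable fun p : (Fin n → ℝ) × (Fin n → ℝ) => p.1 i * p.2 i := (hm₁ i).mul (hm₂ i)
    rw [hν, integral_map hN.aemeasurable hm.aestronglyMeasurable]
    simp only [e]
    rw [integral_add (((hzG i).comp_fst (piGaussian n)).const_mul ρ)
      ((hz.mul_prod hw).const_mul σ), integral_const_mul, integral_const_mul,
      integral_prod_mul (fun z : Fin n → ℝ => z i) fun w : Fin n → ℝ => w i, hw0,
      integral_fun_fst fun z => z i * G z i]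
    simp
  have e : ∀ p : (Fin n → ℝ) × (Fin n → ℝ), ∑ i, (p.1 i - p.2 i) ^ 2 =
      ∑ i, (p.1 i ^ 2 + p.2 i ^ 2 - 2 * (p.1 i * p.2 i)) := fun p =>
    Finset.sum_congr rfl fun i _ => by ring
  have hi : ∀ i ∈ Finset.univ, Integrable (fun p : (Fin n → ℝ) × (Fin n → ℝ) =>
      p.1 i ^ 2 + p.2 i ^ 2 - 2 * (p.1 i * p.2 i)) ν := fun i _ =>
    ((hi₁ i).add (hi₂ i)).sub ((hi₃ i).const_mul 2)
  have hI : ∀ i, ∫ p, (p.1 i ^ 2 + p.2 i ^ 2 - 2 * (p.1 i * p.2 i)) ∂ν =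
      ∫ z, z i ^ 2 ∂κ + 1 - 2 * ρ * ∫ z, z i * G z i ∂κ := fun i => by
    have ha : Integrable (fun p : (Fin n → ℝ) × (Fin n → ℝ) => p.1 i ^ 2 + p.2 i ^ 2) ν :=
      (hi₁ i).add (hi₂ i)
    rw [integral_sub ha ((hi₃ i).const_mul 2), integral_add (hi₁ i) (hi₂ i),
      integral_const_mul, hI₁, hI₂, hI₃]
    ring
  simp only [e]
  refine ⟨integrable_finsetSum _ hi, ?_⟩
  rw [integral_finsetSum _ hi, integral_finsetSum _ fun i _ => h2 i,
    integral_finsetSum _ fun i _ => hzG i]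
  simp only [hI, Finset.sum_sub_distrib, Finset.sum_add_distrib, Finset.mul_sum]
  simp

end Coupling

/-! ### The entropy bound -/

section Entropy

lemma coe_lintegral_sub_coe_lintegral {Ω : Type*} [MeasurableSpace Ω] {μ : Measure Ω} {u : Ω → ℝ}
    (hu : Integrable u μ) :
    ((∫⁻ x, ENNReal.ofReal (u x) ∂μ : ℝ≥0∞) : EReal) -
      ((∫⁻ x, ENNReal.ofReal (-u x) ∂μ : ℝ≥0∞) : EReal) = ((∫ x, u x ∂μ : ℝ) : EReal) := by
  have h1 : ∫⁻ x, ENNReal.ofReal (u x) ∂μ ≠ ∞ := hu.lintegral_lt_top.ne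
  have h2 : ∫⁻ x, ENNReal.ofReal (-u x) ∂μ ≠ ∞ := hu.neg.lintegral_lt_top.ne
  rw [integral_eq_lintegral_pos_part_sub_lintegral_neg_part hu, EReal.coe_sub,
    EReal.coe_ennreal_toReal h1, EReal.coe_ennreal_toReal h2]

/-- An integrable majorant bounds the extended integral, with no measurability assumption on the
integrand. -/
lemma eintegral_le_integral {Ω : Type*} [MeasurableSpace Ω] {μ : Measure Ω} {f : Ω → EReal}
    {u : Ω → ℝ} (hu : Integrable u μ) (h : ∀ᵐ x ∂μ, f x ≤ (u x : EReal)) :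
    eintegral μ f ≤ ((∫ x, u x ∂μ : ℝ) : EReal) := by
  rw [← coe_lintegral_sub_coe_lintegral hu, eintegral]
  refine EReal.sub_le_sub ?_ ?_
  · refine EReal.coe_ennreal_le_coe_ennreal_iff.2 (lintegral_mono_ae ?_)
    filter_upwards [h] with x hx
    simpa using EReal.toENNReal_le_toENNReal hx
  · refine EReal.coe_ennreal_le_coe_ennreal_iff.2 (lintegral_mono_ae ?_)
    filter_upwards [h] with x hx
    have : -((u x : ℝ) : EReal) = ((-u x : ℝ) : EReal) := by simp
    have h1 := EReal.toENNReal_le_toENNReal (EReal.neg_le_neg_iff.2 hx)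
    rw [this] at h1
    simpa using h1

lemma log_gaussianPDFReal (y : ℝ) :
    Real.log (gaussianPDFReal 0 1 y) = -(Real.log (2 * Real.pi)) / 2 - y ^ 2 / 2 := by
  rw [gaussianPDFReal, Real.log_mul (by positivity) (Real.exp_pos _).ne', Real.log_exp, Real.log_inv,
    Real.log_sqrt (by positivity)]
  simp
  ring

variable {n : ℕ}

/-- The transport bound for the differential entropy of a law on `EuclideanSpace ℝ (Fin n)`; it is
affine in the correlation `𝔼⟪Z, G Z⟫`, hence stable under averaging over a condition. -/
lemma IsGaussianTransport.diffEntropy_le {f : (Fin n → ℝ) → ℝ≥0∞} (hf : Measurable f)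
    [IsProbabilityMeasure (volume.withDensity f)] {G : (Fin n → ℝ) → Fin n → ℝ}
    {r : (Fin n → ℝ) → ℝ} (h : IsGaussianTransport f G r)
    (h2 : ∀ i, Integrable (fun z : Fin n → ℝ => z i ^ 2) (volume.withDensity f))
    {l : ℝ} (hl : 0 < l) :
    diffEntropy volume ((volume.withDensity f).map (WithLp.toLp 2)) ≤
      ((l * ∫ z, ∑ i, z i * G z i ∂volume.withDensity f - n * (1 + Real.log l) +
        n / 2 * (Real.log (2 * Real.pi) + 1) : ℝ) : EReal) := by
  set κ := volume.withDensity f with hκ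
  obtain ⟨hc, hr⟩ := h.moment h2
  have hri : Integrable r κ := by
    refine ⟨h.measurable_rate.aestronglyMeasurable, ?_⟩
    rw [hasFiniteIntegral_iff_ofReal (ae_of_all _ h.nonneg)]
    exact hr.trans_lt ENNReal.ofReal_lt_top
  have hrle : ∫ z, r z ∂κ ≤ ∫ z, ∑ i, z i * G z i ∂κ := by
    rw [integral_eq_lintegral_of_nonneg_ae (ae_of_all _ h.nonneg)
      h.measurable_rate.aestronglyMeasurable]
    exact (ENNReal.toReal_mono ENNReal.ofReal_ne_top hr).trans_eq (ENNReal.toReal_ofReal hc)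
  have hG2i : ∀ i, Integrable (fun z => G z i ^ 2 / 2) κ := fun i =>
    (integrable_eval_sq_of_map_eq h.measurable_map h.map_eq i).div_const 2
  have hs : ∀ i, Integrable (fun z => Real.log (2 * Real.pi) / 2 + G z i ^ 2 / 2) κ := fun i =>
    (integrable_const _).add (hG2i i)
  have hG2 : Integrable (fun z => ∑ i, (Real.log (2 * Real.pi) / 2 + G z i ^ 2 / 2)) κ :=
    integrable_finsetSum _ fun i _ => hs i
  set b : (Fin n → ℝ) → ℝ := fun z =>
    (l * r z - n * (1 + Real.log l)) + ∑ i, (Real.log (2 * Real.pi) / 2 + G z i ^ 2 / 2) with hb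
  have hlr : Integrable (fun z => l * r z - n * (1 + Real.log l)) κ :=
    (hri.const_mul l).sub (integrable_const _)
  have hbi : Integrable b κ := hlr.add hG2
  have hbI : ∫ z, b z ∂κ ≤ l * ∫ z, ∑ i, z i * G z i ∂κ - n * (1 + Real.log l) +
      n / 2 * (Real.log (2 * Real.pi) + 1) := by
    have hsI : ∀ i, ∫ z, (Real.log (2 * Real.pi) / 2 + G z i ^ 2 / 2) ∂κ =
        Real.log (2 * Real.pi) / 2 + 1 / 2 := fun i => by
      have h1 : ∫ z, G z i ^ 2 ∂κ = 1 :=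
        integral_eval_sq_of_map_eq h.measurable_map h.map_eq i
      rw [integral_add (integrable_const _) (hG2i i), integral_const, integral_div, h1]
      simp
    rw [hb, integral_add hlr hG2, integral_sub (hri.const_mul l) (integrable_const _),
      integral_const_mul, integral_finsetSum _ fun i _ => hs i]
    simp only [hsI, integral_const, probReal_univ, one_smul, Finset.sum_const, Finset.card_univ,
      Fintype.card_fin, nsmul_eq_mul]
    have := mul_le_mul_of_nonneg_left hrle hl.le
    linarith
  -- The majorant of the entropy integrand, on `Fin n → ℝ`.
  have hpt : ∀ᵐ z, Real.negMulLog (f z).toReal ≤ (f z).toReal * b z := by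
    filter_upwards [(ae_withDensity_iff hf).1 (h.log_le l hl)] with z hz
    rcases eq_or_ne (f z) 0 with h0 | h0
    · simp [h0]
    · have h1 := hz h0
      simp only [log_gaussianPDFReal] at h1
      rw [Real.negMulLog, neg_mul_comm]
      refine mul_le_mul_of_nonneg_left ?_ ENNReal.toReal_nonneg
      rw [hb]
      have h2 : ∑ i, (-(Real.log (2 * Real.pi)) / 2 - G z i ^ 2 / 2) =
          -∑ i, (Real.log (2 * Real.pi) / 2 + G z i ^ 2 / 2) := by
        rw [← Finset.sum_neg_distrib]
        exact Finset.sum_congr rfl fun i _ => by ring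
      rw [h2] at h1
      linarith
  have hfin : ∀ᵐ z, f z < ∞ := ae_lt_top hf (by
    rw [isProbabilityMeasure_withDensity_iff.1 ‹_›]; exact ENNReal.one_ne_top)
  have hfb : Integrable (fun z => (f z).toReal * b z) := by
    rw [hκ, integrable_withDensity_iff_integrable_smul' hf hfin] at hbi
    simpa using hbi
  have hfbI : ∫ z, (f z).toReal * b z = ∫ z, b z ∂κ := by
    rw [hκ, integral_withDensity_eq_integral_toReal_smul hf hfin]
    simp
  -- Transfer to Euclidean space.
  have hof := PiLp.volume_preserving_ofLp (Fin n)
  have hto := PiLp.volume_preserving_toLp (Fin n)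
  have hfE : Measurable fun x : EuclideanSpace ℝ (Fin n) => f (WithLp.ofLp x) :=
    hf.comp hof.measurable
  have hmap : κ.map (WithLp.toLp 2) = (volume : Measure (EuclideanSpace ℝ (Fin n))).withDensity
      fun x => f (WithLp.ofLp x) := by
    refine Measure.ext_of_lintegral _ fun g hg => ?_
    have hg' : Measurable fun z => g (WithLp.toLp 2 z) := hg.comp hto.measurable
    rw [lintegral_map hg hto.measurable, lintegral_withDensity_eq_lintegral_mul _ hfE hg, hκ,
      lintegral_withDensity_eq_lintegral_mul _ hf hg', ← hto.lintegral_comp (hfE.mul hg)]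
    rfl
  have hemb : MeasurableEmbedding (WithLp.ofLp : EuclideanSpace ℝ (Fin n) → Fin n → ℝ) :=
    (MeasurableEquiv.toLp 2 (Fin n → ℝ)).symm.measurableEmbedding
  rw [hmap, diffEntropy]
  refine (eintegral_le_integral (u := fun x : EuclideanSpace ℝ (Fin n) =>
    (f (WithLp.ofLp x)).toReal * b (WithLp.ofLp x)) ?_ ?_).trans ?_
  · exact hof.integrable_comp_of_integrable hfb
  · filter_upwards [Measure.rnDeriv_withDensity volume hfE, hof.quasiMeasurePreserving.ae hpt]
      with x hx hx'
    rw [hx]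
    exact_mod_cast hx'
  · have := hof.integral_comp hemb fun z => (f z).toReal * b z
    rw [this, hfbI]
    exact_mod_cast hbI

end Entropy

section EntropyPower

/-- The bound of the entropy power obtained by optimizing the slope `l` in a family of affine
bounds for the entropy. -/
lemma entropyPower_le_sq {n : ℕ} (hn : 1 ≤ n) {H : EReal} {C : ℝ} (hC : 0 ≤ C)
    (h : ∀ l : ℝ, 0 < l → H ≤ ((l * C - n * (1 + Real.log l) +
      n / 2 * (Real.log (2 * Real.pi) + 1) : ℝ) : EReal)) :
    ENNReal.ofReal (1 / (2 * Real.pi * Real.exp 1)) * EReal.exp (((2 / n : ℝ) : EReal) * H) ≤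
      ENNReal.ofReal ((C / n) ^ 2) := by
  have hn0 : (0 : ℝ) < n := by exact_mod_cast hn
  induction H with
  | bot => rw [EReal.coe_mul_bot_of_pos (by positivity)]; simp
  | top => exact absurd (h 1 one_pos) (not_le.2 (EReal.coe_lt_top _))
  | coe x =>
    have hx : ∀ l : ℝ, 0 < l → x ≤ l * C - n * (1 + Real.log l) +
        n / 2 * (Real.log (2 * Real.pi) + 1) := fun l hl => by exact_mod_cast h l hl
    rw [← EReal.coe_mul, EReal.exp_coe, ← ENNReal.ofReal_mul (by positivity)]
    refine ENNReal.ofReal_le_ofReal ?_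
    rcases hC.eq_or_lt with rfl | hC
    · exfalso
      have := hx (Real.exp ((n / 2 * (Real.log (2 * Real.pi) + 1) - x) / n)) (Real.exp_pos _)
      rw [Real.log_exp] at this
      field_simp at this
      linarith
    · have h1 := hx (n / C) (by positivity)
      rw [Real.log_div hn0.ne' hC.ne', div_mul_cancel₀ _ hC.ne'] at h1
      have h2 : 2 / n * x ≤ 2 * (Real.log C - Real.log n) + (Real.log (2 * Real.pi) + 1) := by
        rw [div_mul_eq_mul_div, div_le_iff₀ hn0]
        linarith
      calc 1 / (2 * Real.pi * Real.exp 1) * Real.exp (2 / n * x)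
          ≤ 1 / (2 * Real.pi * Real.exp 1) *
            Real.exp (2 * (Real.log C - Real.log n) + (Real.log (2 * Real.pi) + 1)) := by gcongr
        _ = (C / n) ^ 2 := by
          rw [Real.exp_add, Real.exp_add, Real.exp_log (by positivity), two_mul (_ - _),
            Real.exp_add, Real.exp_sub, Real.exp_log hC, Real.exp_log hn0]
          field_simp

end EntropyPower

/-! ### Conditional couplings -/

section ConditionalCoupling

variable {τ : Type*} [MeasurableSpace τ] {n : ℕ} {ρ σ : ℝ} {v : ℝ≥0}

/-- A Markov kernel into `Fin n → ℝ` whose values are absolutely continuous with respect to the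
Gaussian law has a jointly measurable family of Lebesgue densities. -/
lemma exists_measurable_density (κ : Kernel τ (Fin n → ℝ)) [IsMarkovKernel κ]
    (h : ∀ t, κ t ≪ piGaussian n) : ∃ f : τ → (Fin n → ℝ) → ℝ≥0∞,
      Measurable (Function.uncurry f) ∧ ∀ t, volume.withDensity (f t) = κ t := by
  set g := κ.rnDeriv (Kernel.const τ (piGaussian n)) with hg
  have hgm : Measurable fun p : τ × (Fin n → ℝ) => g p.1 p.2 := Kernel.measurable_rnDeriv _ _
  refine ⟨fun t z => (∏ i, gaussianPDF 0 1 (z i)) * g t z,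
    ((measurable_prod_gaussianPDF n).comp measurable_snd).mul hgm, fun t => ?_⟩
  have hgt : Measurable (g t) := hgm.comp measurable_prodMk_left
  have h1 := withDensity_mul (volume : Measure (Fin n → ℝ)) (measurable_prod_gaussianPDF n) hgt
  rw [← piGaussian_eq_withDensity] at h1
  have h2 : ((Kernel.const τ (piGaussian n)).withDensity g) t = κ t :=
    Kernel.withDensity_rnDeriv_eq (by simpa using h t)
  rw [Kernel.withDensity_apply _ hgm, Kernel.const_apply] at h2
  exact h1.trans h2

/-- The conditional law of `(Z, ρ G_T(Z) + σ W)` given `T`. -/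
noncomputable def noisyKernel (κ : Kernel τ (Fin n → ℝ)) (G : τ → (Fin n → ℝ) → Fin n → ℝ)
    (ρ σ : ℝ) : Kernel τ ((Fin n → ℝ) × (Fin n → ℝ)) :=
  ((Kernel.id ×ₖ κ) ×ₖ Kernel.const τ (piGaussian n)).map
    fun q => noisy ρ σ (G q.1.1) (q.1.2, q.2)

lemma measurable_noisy_param {G : τ → (Fin n → ℝ) → Fin n → ℝ}
    (hG : Measurable (Function.uncurry G)) :
    Measurable fun q : (τ × (Fin n → ℝ)) × (Fin n → ℝ) =>
      noisy ρ σ (G q.1.1) (q.1.2, q.2) :=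
  measurable_fst.snd.prodMk (measurable_affine (hG.comp measurable_fst) measurable_snd)

lemma noisyKernel_apply (κ : Kernel τ (Fin n → ℝ)) [IsMarkovKernel κ]
    {G : τ → (Fin n → ℝ) → Fin n → ℝ} (hG : Measurable (Function.uncurry G)) (t : τ) :
    noisyKernel κ G ρ σ t = ((κ t).prod (piGaussian n)).map (noisy ρ σ (G t)) := by
  have hm := measurable_noisy_param (ρ := ρ) (σ := σ) hG
  have hGt : Measurable (G t) := hG.comp measurable_prodMk_left
  refine Measure.ext_of_lintegral _ fun u hu => ?_
  have hum : Measurable fun q : (τ × (Fin n → ℝ)) × (Fin n → ℝ) =>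
      u (noisy ρ σ (G q.1.1) (q.1.2, q.2)) := hu.comp hm
  have hum' : Measurable fun q : (Fin n → ℝ) × (Fin n → ℝ) => u (noisy ρ σ (G t) q) :=
    hu.comp (measurable_noisy hGt)
  have hi := hum.lintegral_prod_right' (ν := piGaussian n)
  rw [noisyKernel, Kernel.map_apply _ hm, lintegral_map hu hm, lintegral_map hu (measurable_noisy hGt),
    Kernel.prod_apply, Kernel.prod_apply, Kernel.id_apply, Kernel.const_apply,
    lintegral_prod _ hum.aemeasurable, lintegral_prod _ hi.aemeasurable,
    lintegral_dirac' _ hi.lintegral_prod_right', lintegral_prod _ hum'.aemeasurable]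

lemma isMarkovKernel_noisyKernel (κ : Kernel τ (Fin n → ℝ)) [IsMarkovKernel κ]
    {G : τ → (Fin n → ℝ) → Fin n → ℝ} (hG : Measurable (Function.uncurry G)) :
    IsMarkovKernel (noisyKernel κ G ρ σ) :=
  Kernel.IsMarkovKernel.map _ (measurable_noisy_param hG)

end ConditionalCoupling

section Euclidean

variable {τ : Type*} [MeasurableSpace τ] {n : ℕ}

lemma enorm_sq_eq_ofReal_sum (x : EuclideanSpace ℝ (Fin n)) :
    ‖x‖ₑ ^ 2 = ENNReal.ofReal (∑ i, x i ^ 2) := by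
  rw [← ofReal_norm, ← ENNReal.ofReal_pow (norm_nonneg x), EuclideanSpace.norm_sq_eq]
  simp

lemma edist_rpow_two_eq_ofReal_sum (x y : EuclideanSpace ℝ (Fin n)) :
    edist x y ^ (2 : ℝ) = ENNReal.ofReal (∑ i, (x i - y i) ^ 2) := by
  rw [edist_eq_enorm_sub, ENNReal.rpow_ofNat, enorm_sq_eq_ofReal_sum]
  simp

lemma secondMoment_eq (PT : Measure τ) (κ : Kernel τ (Fin n → ℝ)) :
    secondMoment PT (κ.map (WithLp.toLp 2) : Kernel τ (EuclideanSpace ℝ (Fin n))) =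
      ∫⁻ t, ∫⁻ z, ENNReal.ofReal (∑ i, z i ^ 2) ∂κ t ∂PT := by
  have hto : Measurable (WithLp.toLp 2 : (Fin n → ℝ) → EuclideanSpace ℝ (Fin n)) :=
    (PiLp.volume_preserving_toLp (Fin n)).measurable
  rw [secondMoment, Measure.lintegral_bind (Kernel.aemeasurable _) (by fun_prop)]
  refine lintegral_congr fun t => ?_
  rw [Kernel.lintegral_map _ hto _ (by fun_prop)]
  simp only [enorm_sq_eq_ofReal_sum]

/-- The squared constrained Wasserstein distance is at most the cost of any admissible conditional
coupling, given in coordinates. -/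
lemma condInfoWasserstein_sq_le (PT : Measure τ) [SFinite PT]
    {PZ PY : Kernel τ (EuclideanSpace ℝ (Fin n))}
    (π : Kernel τ ((Fin n → ℝ) × (Fin n → ℝ))) [IsMarkovKernel π]
    (hZ : π.fst.map (WithLp.toLp 2) = PZ) (hY : π.snd.map (WithLp.toLp 2) = PY) {R : ℝ≥0}
    (hR : condMutualInfo PT π ≤ R) :
    condInfoWasserstein 2 PZ PY PT R ^ 2 ≤
      ∫⁻ t, ∫⁻ p, ENNReal.ofReal (∑ i, (p.1 i - p.2 i) ^ 2) ∂π t ∂PT := by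
  have hto : Measurable (WithLp.toLp 2 : (Fin n → ℝ) → EuclideanSpace ℝ (Fin n)) :=
    (PiLp.volume_preserving_toLp (Fin n)).measurable
  have hto2 := hto.prodMap hto
  set π' : Kernel τ (EuclideanSpace ℝ (Fin n) × EuclideanSpace ℝ (Fin n)) :=
    π.map (Prod.map (WithLp.toLp 2) (WithLp.toLp 2)) with hπ'
  have hM : IsMarkovKernel π' := Kernel.IsMarkovKernel.map _ hto2
  have hmem : π' ∈ {π ∈ condCouplings PZ PY | condMutualInfo PT π ≤ (R : ℝ≥0∞)} := by
    refine ⟨⟨hM, ?_, ?_⟩, ?_⟩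
    · rw [← hZ, Kernel.fst_eq, Kernel.fst_eq, hπ', ← Kernel.map_comp_right _ hto2 measurable_fst,
        ← Kernel.map_comp_right _ measurable_fst hto]
      rfl
    · rw [← hY, Kernel.snd_eq, Kernel.snd_eq, hπ', ← Kernel.map_comp_right _ hto2 measurable_snd,
        ← Kernel.map_comp_right _ measurable_snd hto]
      rfl
    · refine (lintegral_mono fun t => ?_).trans hR
      rw [hπ', Kernel.map_apply _ hto2]
      exact mutualInfo_map_le _ hto hto
  have hcost : Measurable fun x : τ × EuclideanSpace ℝ (Fin n) × EuclideanSpace ℝ (Fin n) =>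
      edist x.2.1 x.2.2 ^ (2 : ℝ) := by fun_prop
  have hcost' : Measurable fun x : EuclideanSpace ℝ (Fin n) × EuclideanSpace ℝ (Fin n) =>
      edist x.1 x.2 ^ (2 : ℝ) := by fun_prop
  have h1 : condInfoWasserstein 2 PZ PY PT R ≤
      (∫⁻ x, edist x.2.1 x.2.2 ^ (2 : ℝ) ∂(PT ⊗ₘ π')) ^ (1 / 2 : ℝ) := iInf₂_le π' hmem
  refine (pow_le_pow_left' h1 2).trans_eq ?_
  rw [← ENNReal.rpow_ofNat, ← ENNReal.rpow_mul]
  norm_num only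
  rw [ENNReal.rpow_one, Measure.lintegral_compProd hcost]
  refine lintegral_congr fun t => ?_
  rw [hπ', Kernel.lintegral_map _ hto2 _ hcost']
  simp only [edist_rpow_two_eq_ofReal_sum, Prod.map_fst, Prod.map_snd]

end Euclidean

end CondOT

theorem theoremT {τ : Type*} [MeasurableSpace τ] (n : ℕ) (hn : 1 ≤ n)
    (PT : Measure τ) [IsProbabilityMeasure PT]
    (PZ PY : Kernel τ (EuclideanSpace ℝ (Fin n))) [IsMarkovKernel PZ] [IsMarkovKernel PY]
    (hPY : ∀ t, PY t = stdGaussian (EuclideanSpace ℝ (Fin n)))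
    (hPZ : ∀ t, PZ t ≪ stdGaussian (EuclideanSpace ℝ (Fin n)))
    -- the right-hand side below is not of the form `∞ - ∞`
    (hdef : ¬ (CondOT.secondMoment PT PZ = ⊤ ∧ CondOT.condDiffEntropy volume PT PZ = ⊤))
    (R : ℝ≥0) :
    (((CondOT.condInfoWasserstein 2 PZ PY PT R) ^ 2 : ℝ≥0∞) : EReal) ≤
      (CondOT.secondMoment PT PZ : EReal) + (n : EReal) -
        ((2 * (n : ℝ≥0∞) * (CondOT.condEntropyPower n PT PZ *
          ENNReal.ofReal (1 - Real.exp (-(2 * (R : ℝ) / n)))) ^ (1 / 2 : ℝ) : ℝ≥0∞) : EReal) := by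
  have hn0 : (0 : ℝ) < n := by exact_mod_cast hn
  have hto : Measurable (WithLp.toLp 2 : (Fin n → ℝ) → EuclideanSpace ℝ (Fin n)) :=
    (PiLp.volume_preserving_toLp (Fin n)).measurable
  have hof : Measurable (WithLp.ofLp : EuclideanSpace ℝ (Fin n) → Fin n → ℝ) :=
    (PiLp.volume_preserving_ofLp (Fin n)).measurable
  by_cases hSM : CondOT.secondMoment PT PZ = ⊤
  · -- The right-hand side is `⊤`, because the entropy is not.
    have hH : CondOT.condDiffEntropy volume PT PZ ≠ ⊤ := fun h => hdef ⟨hSM, h⟩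
    have hN : CondOT.condEntropyPower n PT PZ ≠ ⊤ := by
      refine ENNReal.mul_ne_top ENNReal.ofReal_ne_top fun h => hH ?_
      rw [EReal.exp_eq_top_iff, EReal.mul_eq_top] at h
      have h2 : (0 : ℝ) < 2 / n := by positivity
      rcases h with ⟨h, -⟩ | ⟨h, -⟩ | ⟨h, -⟩ | ⟨-, h⟩
      · exact absurd h (EReal.coe_ne_bot _)
      · exact absurd h (by exact_mod_cast h2.le.not_gt)
      · exact absurd h (EReal.coe_ne_top _)
      · exact h
    have hx : (2 * (n : ℝ≥0∞) * (CondOT.condEntropyPower n PT PZ *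
        ENNReal.ofReal (1 - Real.exp (-(2 * (R : ℝ) / n)))) ^ (1 / 2 : ℝ) : ℝ≥0∞) ≠ ⊤ :=
      ENNReal.mul_ne_top (ENNReal.mul_ne_top (by simp) (by simp))
        (ENNReal.rpow_ne_top_of_nonneg (by norm_num) (ENNReal.mul_ne_top hN ENNReal.ofReal_ne_top))
    rw [hSM, ← EReal.coe_ennreal_toReal hx, EReal.coe_ennreal_top,
      EReal.top_add_of_ne_bot (EReal.natCast_ne_bot n), EReal.top_sub_coe]
    exact le_top
  -- The conditional laws in coordinates, their densities, and the Knothe maps.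
  set κ : Kernel τ (Fin n → ℝ) := PZ.map WithLp.ofLp with hκ
  have hκM : IsMarkovKernel κ := Kernel.IsMarkovKernel.map _ hof
  have hκto : κ.map (WithLp.toLp 2) = PZ := by
    rw [hκ, ← Kernel.map_comp_right _ hof hto]
    exact Kernel.map_id _
  have hac : ∀ t, κ t ≪ CondOT.piGaussian n := fun t => by
    have h1 := (hPZ t).map hof
    rw [← map_pi_eq_stdGaussian, Measure.map_map hof hto] at h1
    rw [hκ, Kernel.map_apply _ hof]
    have h2 : (CondOT.piGaussian n).map (WithLp.ofLp ∘ WithLp.toLp 2) = CondOT.piGaussian n :=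
      Measure.map_id
    rwa [h2] at h1
  obtain ⟨f, hf, hfκ⟩ := CondOT.exists_measurable_density κ hac
  have hprob : ∀ t, IsProbabilityMeasure (volume.withDensity (f t)) := fun t => by
    rw [hfκ]; infer_instance
  obtain ⟨G, r, hG, -, hGr⟩ := CondOT.exists_isGaussianTransport n f hf hprob
  have hGt : ∀ t, Measurable (G t) := fun t => (hGr t).measurable_map
  have hmap : ∀ t, (κ t).map (G t) = CondOT.piGaussian n := fun t => by
    rw [← hfκ]; exact (hGr t).map_eq
  -- Second moments.
  have hsqm : Measurable fun z : Fin n → ℝ => ∑ i, z i ^ 2 := by fun_prop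
  set m : τ → ℝ≥0∞ := fun t => ∫⁻ z, ENNReal.ofReal (∑ i, z i ^ 2) ∂κ t with hm
  have hmm : Measurable m := hsqm.ennreal_ofReal.lintegral_kernel
  have hmS : ∫⁻ t, m t ∂PT = CondOT.secondMoment PT PZ := by
    rw [← hκto, CondOT.secondMoment_eq]
  have hmfin : ∀ᵐ t ∂PT, m t < ∞ := ae_lt_top hmm (by rwa [hmS])
  have hsq0 : ∀ z : Fin n → ℝ, 0 ≤ ∑ i, z i ^ 2 := fun z => Finset.sum_nonneg fun i _ => sq_nonneg _
  have hmI : ∀ t, ∫ z, ∑ i, z i ^ 2 ∂κ t = (m t).toReal := fun t =>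
    integral_eq_lintegral_of_nonneg_ae (ae_of_all _ hsq0) hsqm.aestronglyMeasurable
  have hm2 : ∀ t, m t < ∞ → ∀ i, Integrable (fun z : Fin n → ℝ => z i ^ 2) (κ t) := by
    intro t ht i
    have h1 : Integrable (fun z : Fin n → ℝ => ∑ i, z i ^ 2) (κ t) :=
      ⟨hsqm.aestronglyMeasurable, by
        rwa [hasFiniteIntegral_iff_ofReal (ae_of_all _ hsq0)]⟩
    refine h1.mono' ((measurable_pi_apply i).pow_const 2).aestronglyMeasurable (ae_of_all _ fun z => ?_)
    rw [Real.norm_of_nonneg (sq_nonneg _)]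
    exact Finset.single_le_sum (f := fun i => z i ^ 2) (fun i _ => sq_nonneg _) (Finset.mem_univ i)
  have hmi : Integrable (fun t => (m t).toReal) PT :=
    integrable_toReal_of_lintegral_ne_top hmm.aemeasurable (by rwa [hmS])
  have hmiI : ∫ t, (m t).toReal ∂PT = (CondOT.secondMoment PT PZ).toReal := by
    rw [integral_toReal hmm.aemeasurable hmfin, hmS]
  -- The correlations `c t` of `Z` and `G_t(Z)`, and their mean `C`.
  set c : τ → ℝ := fun t => ∫ z, ∑ i, z i * G t z i ∂κ t with hc
  have hcm : StronglyMeasurable c := by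
    refine StronglyMeasurable.integral_kernel_prod_right'
      (f := fun p : τ × (Fin n → ℝ) => ∑ i, p.2 i * G p.1 p.2 i) (Measurable.stronglyMeasurable ?_)
    exact Finset.measurable_sum _ fun i _ =>
      (measurable_pi_iff.1 measurable_snd i).mul (measurable_pi_iff.1 hG i)
  have hc0 : ∀ t, m t < ∞ → 0 ≤ c t := fun t ht => by
    have := ((hGr t).moment (by rw [hfκ]; exact hm2 t ht)).1
    rwa [hfκ] at this
  have hG2 : ∀ t i, Integrable (fun z => G t z i ^ 2) (κ t) := fun t =>
    CondOT.integrable_eval_sq_of_map_eq (hGt t) (hmap t)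
  have hcle : ∀ t, m t < ∞ → c t ≤ ((m t).toReal + n) / 2 := fun t ht => by
    have h1 : Integrable (fun z : Fin n → ℝ => ∑ i, z i ^ 2) (κ t) :=
      integrable_finsetSum _ fun i _ => hm2 t ht i
    have h2 : Integrable (fun z : Fin n → ℝ => ∑ i, G t z i ^ 2) (κ t) :=
      integrable_finsetSum _ fun i _ => hG2 t i
    have h3 : ∫ z, ∑ i, G t z i ^ 2 ∂κ t = n := by
      rw [integral_finsetSum _ fun i _ => hG2 t i]
      simp [CondOT.integral_eval_sq_of_map_eq (hGt t) (hmap t)]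
    calc c t ≤ ∫ z, (∑ i, z i ^ 2 + ∑ i, G t z i ^ 2) / 2 ∂κ t := by
          refine integral_mono (integrable_finsetSum _ fun i _ => CondOT.integrable_mul_of_sq
            (measurable_pi_apply i) (measurable_pi_iff.1 (hGt t) i) (hm2 t ht i) (hG2 t i))
            ((h1.add h2).div_const 2) fun z => ?_
          beta_reduce
          rw [← Finset.sum_add_distrib, Finset.sum_div]
          exact Finset.sum_le_sum fun i _ => by nlinarith [sq_nonneg (z i - G t z i)]
      _ = ((m t).toReal + n) / 2 := by
          rw [integral_div, integral_add h1 h2, h3, hmI]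
  have hci : Integrable c PT := by
    refine ((hmi.add (integrable_const (n : ℝ))).div_const 2).mono' hcm.aestronglyMeasurable ?_
    filter_upwards [hmfin] with t ht
    rw [Real.norm_of_nonneg (hc0 t ht)]
    exact hcle t ht
  set C : ℝ := ∫ t, c t ∂PT with hC
  have hC0 : 0 ≤ C := integral_nonneg_of_ae (hmfin.mono hc0)
  -- The entropy power is bounded by the square of the mean correlation per coordinate.
  have hEP : CondOT.condEntropyPower n PT PZ ≤ ENNReal.ofReal ((C / n) ^ 2) := by
    refine CondOT.entropyPower_le_sq hn hC0 fun l hl => ?_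
    have hi : Integrable (fun t => l * c t + (n / 2 * (Real.log (2 * Real.pi) + 1) -
        n * (1 + Real.log l))) PT := (hci.const_mul l).add (integrable_const _)
    refine (CondOT.eintegral_le_integral hi ?_).trans_eq ?_
    · filter_upwards [hmfin] with t ht
      have hft : Measurable (f t) := hf.comp measurable_prodMk_left
      have h1 := (hGr t).diffEntropy_le hft
        (by rw [hfκ]; exact hm2 t ht) hl
      rw [hfκ, ← Kernel.map_apply _ hto, hκto] at h1
      refine h1.trans_eq (congrArg _ ?_)
      rw [hc]
      ring
    · rw [integral_add (hci.const_mul l) (integrable_const _), integral_const_mul, integral_const,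
        probReal_univ, one_smul]
      refine congrArg _ ?_
      ring
  -- The coupling: `Y = ρ G_T(Z) + σ W` with `σ ^ 2 = v = exp (-2R/n)`.
  set v : ℝ≥0 := ⟨Real.exp (-(2 * (R : ℝ) / n)), (Real.exp_pos _).le⟩ with hvdef
  have hvc : (v : ℝ) = Real.exp (-(2 * (R : ℝ) / n)) := rfl
  have hv : v ≠ 0 := fun h => (Real.exp_pos (-(2 * (R : ℝ) / n))).ne' (by rw [← hvc, h]; rfl)
  have hv1 : (v : ℝ) ≤ 1 := by
    rw [hvc, Real.exp_le_one_iff, neg_nonpos]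
    positivity
  set ρ : ℝ := √(1 - v) with hρ
  have hρ0 : 0 ≤ ρ := Real.sqrt_nonneg _
  have hρ2 : ρ ^ 2 = 1 - v := Real.sq_sqrt (by linarith)
  have hσ : √(v : ℝ) ^ 2 = v := Real.sq_sqrt v.2
  have hρv : ρ ^ 2 + v = 1 := by rw [hρ2]; ring
  set π := CondOT.noisyKernel κ G ρ √(v : ℝ) with hπ
  have hπM : IsMarkovKernel π := CondOT.isMarkovKernel_noisyKernel κ hG
  have hπt : ∀ t, π t = ((κ t).prod (CondOT.piGaussian n)).map (CondOT.noisy ρ √(v : ℝ) (G t)) :=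
    CondOT.noisyKernel_apply κ hG
  have hπ1 : π.fst.map (WithLp.toLp 2) = PZ := by
    have : π.fst = κ := Kernel.ext fun t => by
      rw [Kernel.fst_apply, hπt]
      exact CondOT.fst_map_noisy (hGt t)
    rw [this, hκto]
  have hπ2 : π.snd.map (WithLp.toLp 2) = PY := Kernel.ext fun t => by
    have : π.snd t = CondOT.piGaussian n := by
      rw [Kernel.snd_apply, hπt]
      exact CondOT.snd_map_noisy hv hσ hρv (hGt t) (hmap t)
    rw [Kernel.map_apply _ hto, this, hPY, map_pi_eq_stdGaussian]
  have hMI : CondOT.condMutualInfo PT π ≤ R := by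
    refine le_of_eq ?_
    have : ∀ t, CondOT.mutualInfo (π t) = R := fun t => by
      rw [hπt, CondOT.mutualInfo_map_noisy hv hσ hρv (hGt t) (hmap t), hvc, Real.log_exp,
        ← ENNReal.ofReal_coe_nnreal]
      congr 1
      field_simp
    simp [CondOT.condMutualInfo, this]
  have hJ : ∀ t, m t < ∞ → 0 ≤ (m t).toReal + n - 2 * ρ * c t ∧
      ∫⁻ p, ENNReal.ofReal (∑ i, (p.1 i - p.2 i) ^ 2) ∂π t =
        ENNReal.ofReal ((m t).toReal + n - 2 * ρ * c t) := fun t ht => by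
    obtain ⟨h1, h2⟩ := CondOT.integral_sq_sub_noisy hv hσ hρv (hGt t) (hmap t) (hm2 t ht)
    rw [← hπt] at h1 h2
    have h0 : ∀ p : (Fin n → ℝ) × (Fin n → ℝ), 0 ≤ ∑ i, (p.1 i - p.2 i) ^ 2 := fun p =>
      Finset.sum_nonneg fun i _ => sq_nonneg _
    rw [← hmI, hc, ← h2]
    exact ⟨integral_nonneg h0, (ofReal_integral_eq_lintegral_ofReal h1 (ae_of_all _ h0)).symm⟩
  set M : ℝ := (CondOT.secondMoment PT PZ).toReal with hM
  have hi1 : Integrable (fun t => (m t).toReal + (n : ℝ)) PT := hmi.add (integrable_const _)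
  have hi2 : Integrable (fun t => (m t).toReal + n - 2 * ρ * c t) PT := hi1.sub (hci.const_mul _)
  have hJ0 : 0 ≤ᵐ[PT] fun t => (m t).toReal + n - 2 * ρ * c t :=
    hmfin.mono fun t ht => (hJ t ht).1
  have hJI : ∫ t, ((m t).toReal + n - 2 * ρ * c t) ∂PT = M + n - 2 * ρ * C := by
    rw [integral_sub hi1 (hci.const_mul _), integral_add hmi (integrable_const _), hmiI,
      integral_const_mul]
    simp [hC]
  have hW : CondOT.condInfoWasserstein 2 PZ PY PT R ^ 2 ≤ ENNReal.ofReal (M + n - 2 * ρ * C) := by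
    refine (CondOT.condInfoWasserstein_sq_le PT π hπ1 hπ2 hMI).trans_eq ?_
    rw [← hJI, ofReal_integral_eq_lintegral_ofReal hi2 hJ0]
    exact lintegral_congr_ae (hmfin.mono fun t ht => (hJ t ht).2)
  -- Comparison of the two sides, which are now finite.
  have hroot : (CondOT.condEntropyPower n PT PZ *
      ENNReal.ofReal (1 - Real.exp (-(2 * (R : ℝ) / n)))) ^ (1 / 2 : ℝ) ≤
      ENNReal.ofReal (ρ * C / n) := by
    rw [← hvc, ← hρ2]
    calc _ ≤ (ENNReal.ofReal ((C / n) ^ 2) * ENNReal.ofReal (ρ ^ 2)) ^ (1 / 2 : ℝ) := by gcongr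
      _ = ENNReal.ofReal (ρ * C / n) := by
        rw [← ENNReal.ofReal_mul (sq_nonneg _), ← mul_pow,
          ENNReal.ofReal_rpow_of_nonneg (sq_nonneg _) (by norm_num), ← Real.sqrt_eq_rpow,
          Real.sqrt_sq (by positivity)]
        congr 1
        ring
  have hrhs : (2 * (n : ℝ≥0∞) * (CondOT.condEntropyPower n PT PZ *
      ENNReal.ofReal (1 - Real.exp (-(2 * (R : ℝ) / n)))) ^ (1 / 2 : ℝ) : ℝ≥0∞) ≤
      ENNReal.ofReal (2 * ρ * C) := by
    calc _ ≤ 2 * (n : ℝ≥0∞) * ENNReal.ofReal (ρ * C / n) := by gcongr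
      _ = ENNReal.ofReal (2 * ρ * C) := by
        rw [← ENNReal.ofReal_natCast, ← ENNReal.ofReal_ofNat, ← ENNReal.ofReal_mul (by norm_num),
          ← ENNReal.ofReal_mul (by positivity)]
        congr 1
        field_simp
  have hX0 : 0 ≤ M + n - 2 * ρ * C := by rw [← hJI]; exact integral_nonneg_of_ae hJ0
  calc (((CondOT.condInfoWasserstein 2 PZ PY PT R) ^ 2 : ℝ≥0∞) : EReal)
      ≤ ((ENNReal.ofReal (M + n - 2 * ρ * C) : ℝ≥0∞) : EReal) :=
        EReal.coe_ennreal_le_coe_ennreal_iff.2 hW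
    _ = (CondOT.secondMoment PT PZ : EReal) + (n : EReal) -
        ((ENNReal.ofReal (2 * ρ * C) : ℝ≥0∞) : EReal) := by
        rw [EReal.coe_ennreal_ofReal, EReal.coe_ennreal_ofReal, max_eq_left hX0,
          max_eq_left (by positivity), ← EReal.coe_ennreal_toReal hSM, ← hM]
        push_cast
        rfl
    _ ≤ _ := EReal.sub_le_sub le_rfl (EReal.coe_ennreal_le_coe_ennreal_iff.2 hrhs)
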